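/- Let $\Omega \subset \mathbb{C}^n$ be a bounded pseudoconvex domain (a bounded, nonempty, connected open set admitting a continuous plurisubharmonic exhaustion function). For $s \ge 0$ let $L^\infty_{(0,s)}(\Omega)$ be the space of $(0,s)$-forms $\sum_J f_J\, d\bar z_J$ (sum over strictly increasing multi-indices $J$ of length $s$) whose coefficients $f_J$ are measurable and essentially bounded on $\Omega$, and let $\overline\partial$ be taken in the sense of distributions on $\Omega$. Assume that $\Omega$ is $L^\infty$-pseudoconvex, that is: for every $s \ge 1$ and every $\beta \in L^\infty_{(0,s)}(\Omega)$ with $\overline\partial \beta = 0$ there exists $u \in L^\infty_{(0,s-1)}(\Omega)$ with $\overline\partial u = \beta$. Then $\Omega$ is Gleason solvable: for every $\alpha = (\alpha_1,\dots,\alpha_n) \in \Omega$ and every bounded holomorphic function $g$ on $\Omega$ with $g(\alpha) = 0$, there exist bounded holomorphic functions $g_1,\dots,g_n$ on $\Omega$ such that $$g(z) = \sum_{j=1}^n (z_j - \alpha_j)\, g_j(z) \qquad \text{for all } z \in \Omega.$$ -/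

import Mathlib

open MeasureTheory
open scoped ContDiff ENNReal

noncomputable section

namespace SCV

/-- A function is holomorphic and bounded on `Ω ⊆ ℂⁿ`, i.e. it represents an element of
`H^∞(Ω)`. Only the values on `Ω` matter. -/
def IsBoundedHolomorphic {n : ℕ} (Ω : Set (Fin n → ℂ)) (g : (Fin n → ℂ) → ℂ) : Prop :=
  DifferentiableOn ℂ g Ω ∧ ∃ C : ℝ, ∀ z ∈ Ω, ‖g z‖ ≤ C

/-- Gleason solvability of `Ω`: for every `a ∈ Ω`, each bounded holomorphic function vanishing
at `a` is a combination of `z₁ - a₁, …, zₙ - aₙ` with bounded holomorphic coefficients. -/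
def IsGleasonSolvable {n : ℕ} (Ω : Set (Fin n → ℂ)) : Prop :=
  ∀ a ∈ Ω, ∀ g : (Fin n → ℂ) → ℂ, IsBoundedHolomorphic Ω g → g a = 0 →
    ∃ G : Fin n → (Fin n → ℂ) → ℂ, (∀ j, IsBoundedHolomorphic Ω (G j)) ∧
      ∀ z ∈ Ω, g z = ∑ j, (z j - a j) * G j z

/-- Continuous plurisubharmonic functions on an open set `Ω`: the sub-mean value inequality holds
on every closed affine complex disc contained in `Ω`. -/
def IsContinuousPlurisubharmonicOn {n : ℕ} (ρ : (Fin n → ℂ) → ℝ) (Ω : Set (Fin n → ℂ)) : Prop :=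
  ContinuousOn ρ Ω ∧ ∀ z w : Fin n → ℂ, (∀ t : ℂ, ‖t‖ ≤ 1 → z + t • w ∈ Ω) →
    ρ z ≤ Real.circleAverage (fun t : ℂ => ρ (z + t • w)) 0 1

/-- Pseudoconvexity of an open set: existence of a continuous plurisubharmonic exhaustion
function. -/
def IsPseudoconvex {n : ℕ} (Ω : Set (Fin n → ℂ)) : Prop :=
  ∃ ρ : (Fin n → ℂ) → ℝ, IsContinuousPlurisubharmonicOn ρ Ω ∧
    ∀ c : ℝ, IsCompact {z | z ∈ Ω ∧ ρ z ≤ c}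

/-- Strictly increasing multi-indices `j₁ < … < jₛ` in `{1, …, n}`, encoded as `s`-element
subsets. -/
abbrev MultiIndex (n s : ℕ) : Type := {J : Finset (Fin n) // J.card = s}

/-- A `(0,s)`-form `∑_J f_J dz̄_J` on `ℂⁿ` (summed over strictly increasing multi-indices `J`),
given by its coefficient functions `f_J`. -/
abbrev ZeroForm (n s : ℕ) : Type := MultiIndex n s → (Fin n → ℂ) → ℂ

/-- Remove the index `k` from the multi-index `K`. -/
def MultiIndex.remove {n s : ℕ} (K : MultiIndex n (s + 1)) (k : {k : Fin n // k ∈ K.1}) :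
    MultiIndex n s :=
  ⟨K.1.erase k.1, by rw [Finset.card_erase_of_mem k.2, K.2]; rfl⟩

/-- The sign `ε` with `dz̄_k ∧ dz̄_{K ∖ {k}} = ε dz̄_K`, for `k ∈ K`. -/
def MultiIndex.sign {n s : ℕ} (K : MultiIndex n s) (k : Fin n) : ℂ :=
  (-1) ^ (K.1.filter (fun j => j < k)).card

/-- The Wirtinger derivative `∂φ/∂z̄_k = (∂φ/∂x_k + i ∂φ/∂y_k) / 2`. -/
def dbar {n : ℕ} (k : Fin n) (φ : (Fin n → ℂ) → ℂ) (z : Fin n → ℂ) : ℂ :=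
  (1 / 2) * (fderiv ℝ φ z (Pi.single k 1) + Complex.I * fderiv ℝ φ z (Pi.single k Complex.I))

/-- Test functions on `Ω`: smooth functions with compact support contained in `Ω`. -/
def IsTestFunction {n : ℕ} (Ω : Set (Fin n → ℂ)) (φ : (Fin n → ℂ) → ℂ) : Prop :=
  ContDiff ℝ ∞ φ ∧ HasCompactSupport φ ∧ tsupport φ ⊆ Ω

/-- `L^∞_{(0,s)}(Ω)`: forms whose coefficients are measurable and essentially bounded on `Ω`. -/
def IsLInftyForm {n s : ℕ} (Ω : Set (Fin n → ℂ)) (f : ZeroForm n s) : Prop :=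
  ∀ J, MemLp (f J) ∞ (volume.restrict Ω)

/-- `∂̄f = h` on `Ω` in the sense of distributions: for each `K`, the `K`-th coefficient
`∑_{k ∈ K} ε(k, K) ∂f_{K ∖ {k}}/∂z̄_k` of `∂̄f` equals `h_K` when tested against every test
function. Meant for forms with locally integrable coefficients. -/
def WeakDbarEq {n s : ℕ} (Ω : Set (Fin n → ℂ)) (f : ZeroForm n s) (h : ZeroForm n (s + 1)) :
    Prop :=
  ∀ K : MultiIndex n (s + 1), ∀ φ : (Fin n → ℂ) → ℂ, IsTestFunction Ω φ →
    ∑ k : {k : Fin n // k ∈ K.1}, K.sign k.1 * ∫ z in Ω, f (K.remove k) z * dbar k.1 φ z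
      = -∫ z in Ω, h K z * φ z

/-- A bounded `L^∞`-pseudoconvex domain in `ℂⁿ`: a bounded pseudoconvex domain on which every
`∂̄`-closed form in `L^∞_{(0,s+1)}(Ω)`, `s ≥ 0`, is `∂̄` of a form in `L^∞_{(0,s)}(Ω)`. -/
structure IsLInftyPseudoconvexDomain {n : ℕ} (Ω : Set (Fin n → ℂ)) : Prop where
  isOpen : IsOpen Ω
  isConnected : IsConnected Ω
  isBounded : Bornology.IsBounded Ω
  isPseudoconvex : IsPseudoconvex Ω
  solvable : ∀ (s : ℕ) (β : ZeroForm n (s + 1)), IsLInftyForm Ω β → WeakDbarEq Ω β 0 →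
    ∃ α : ZeroForm n s, IsLInftyForm Ω α ∧ WeakDbarEq Ω α β

end SCV

end

/-! The proof runs the Koszul complex of z - a against the ∂̄-complex. Dividing g with smooth
coefficients is easy: away from a one uses conj(z_j - a_j)/|z - a|², near a Hadamard's lemma gives
holomorphic coefficients. Gluing the two yields bounded u_j with g = ∑ (z_j - a_j) u_j whose ∂̄ is
bounded and vanishes near a (`exists_bounded_decomposition`). It remains to subtract bounded w_j
with ∂̄w_j = ∂̄u_j and ∑ (z_j - a_j) w_j = 0.

Let P be contraction with z - a on the exterior algebra of ℂⁿ and X exterior multiplication by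
smooth ξ_j with ∑ (z_j - a_j) ξ_j = 1 off a neighbourhood of a. Then P² = 0, and PX + XP = 1 off
that neighbourhood. If b is bounded, ∂̄-closed, P-closed and zero on the neighbourhood, then b =
P(Xb), and ∂̄(Xb) is again such a form, one degree higher. By descending induction ∂̄(Xb) = ∂̄w'
with Pw' = 0; L^∞-solvability gives ∂̄y = Xb - w', and w = Py satisfies both ∂̄w = b and Pw = 0,
because P has holomorphic entries (`exists_weakDbarEq_mulForm_eq_zero`). Only multiplications by
smooth functions occur besides solving ∂̄, so all bounds survive.

With v = ∑ u_j F_j e the difference v - w is bounded and weakly holomorphic, hence holomorphic by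
Weyl's lemma (`IsWeaklyHolomorphicOn.exists_isBoundedHolomorphic`), and one component of P(v - w) =
g e is the desired identity. The grading of the exterior algebra is never needed: matrices with the
right anticommutation relations and a vector e killed by all contractions suffice. -/

noncomputable section

namespace SCV

/-! ### Wirtinger derivatives and test functions -/

section

variable {n : ℕ}

theorem dbar_mul {φ ψ : (Fin n → ℂ) → ℂ} {z : Fin n → ℂ} (k : Fin n)
    (hφ : DifferentiableAt ℝ φ z) (hψ : DifferentiableAt ℝ ψ z) :
    dbar k (fun z => φ z * ψ z) z = φ z * dbar k ψ z + ψ z * dbar k φ z := by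
  unfold dbar
  rw [fderiv_fun_mul hφ hψ]
  simp only [add_apply, smul_apply, smul_eq_mul]
  ring

theorem dbar_add {φ ψ : (Fin n → ℂ) → ℂ} {z : Fin n → ℂ} (k : Fin n)
    (hφ : DifferentiableAt ℝ φ z) (hψ : DifferentiableAt ℝ ψ z) :
    dbar k (fun z => φ z + ψ z) z = dbar k φ z + dbar k ψ z := by
  unfold dbar
  rw [fderiv_fun_add hφ hψ]
  simp only [add_apply]
  ring

theorem dbar_sum {ι : Type*} (s : Finset ι) {φ : ι → (Fin n → ℂ) → ℂ} {z : Fin n → ℂ} (k : Fin n)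
    (hφ : ∀ i ∈ s, DifferentiableAt ℝ (φ i) z) :
    dbar k (fun z => ∑ i ∈ s, φ i z) z = ∑ i ∈ s, dbar k (φ i) z := by
  unfold dbar
  rw [fderiv_fun_sum hφ]
  simp only [sum_apply, Finset.mul_sum, ← Finset.sum_add_distrib]

theorem dbar_eq_zero_of_differentiableAt {φ : (Fin n → ℂ) → ℂ} {z : Fin n → ℂ} (k : Fin n)
    (hφ : DifferentiableAt ℂ φ z) : dbar k φ z = 0 := by
  have h := (hφ.hasFDerivAt.restrictScalars ℝ).fderiv
  unfold dbar
  rw [h]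
  have : (Pi.single k Complex.I : Fin n → ℂ) = Complex.I • Pi.single k 1 := by
    rw [← Pi.single_smul]; simp
  simp only [ContinuousLinearMap.coe_restrictScalars', this, map_smul, smul_eq_mul]
  rw [← mul_assoc Complex.I, Complex.I_mul_I]
  ring

theorem dbar_congr {φ ψ : (Fin n → ℂ) → ℂ} {z : Fin n → ℂ} (k : Fin n)
    (h : φ =ᶠ[nhds z] ψ) : dbar k φ z = dbar k ψ z := by
  unfold dbar
  rw [h.fderiv_eq]

theorem dbar_const (k : Fin n) (c : ℂ) (z : Fin n → ℂ) : dbar k (fun _ => c) z = 0 :=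
  dbar_eq_zero_of_differentiableAt k (differentiableAt_const c)

theorem contDiff_dbar {φ : (Fin n → ℂ) → ℂ} (hφ : ContDiff ℝ ∞ φ) (k : Fin n) :
    ContDiff ℝ ∞ (dbar k φ) := by
  have h : ContDiff ℝ ∞ (fderiv ℝ φ) := hφ.fderiv_right (by simp)
  unfold dbar
  fun_prop

theorem dbar_comm {φ : (Fin n → ℂ) → ℂ} (hφ : ContDiff ℝ ∞ φ) (k l : Fin n) (z : Fin n → ℂ) :
    dbar k (dbar l φ) z = dbar l (dbar k φ) z := by
  have h : ContDiff ℝ ∞ (fderiv ℝ φ) := hφ.fderiv_right (by simp)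
  have hd : DifferentiableAt ℝ (fderiv ℝ φ) z := h.differentiable (by simp) z
  have hs : IsSymmSndFDerivAt ℝ φ z :=
    (hφ.contDiffAt (x := z)).isSymmSndFDerivAt (by
      simpa using WithTop.coe_le_coe.2 (le_top : (2 : ℕ∞) ≤ ⊤))
  have key : ∀ m : Fin n, ∀ v : Fin n → ℂ, fderiv ℝ (dbar m φ) z v =
      (1 / 2) * (fderiv ℝ (fderiv ℝ φ) z v (Pi.single m 1) +
        Complex.I * fderiv ℝ (fderiv ℝ φ) z v (Pi.single m Complex.I)) := by
    intro m v
    have h1 : ∀ w : Fin n → ℂ, HasFDerivAt (fun y => fderiv ℝ φ y w)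
        ((fderiv ℝ (fderiv ℝ φ) z).flip w) z := fun w => by
      simpa using hd.hasFDerivAt.clm_apply (hasFDerivAt_const w z)
    have := (((h1 (Pi.single m 1)).add
      ((h1 (Pi.single m Complex.I)).const_mul Complex.I)).const_mul (1 / 2 : ℂ)).fderiv
    unfold dbar
    erw [this]
    simp [mul_add]
  rw [dbar, dbar, key, key, key, key]
  rw [hs.eq (Pi.single k 1) (Pi.single l 1), hs.eq (Pi.single k 1) (Pi.single l Complex.I),
    hs.eq (Pi.single k Complex.I) (Pi.single l 1),
    hs.eq (Pi.single k Complex.I) (Pi.single l Complex.I)]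
  ring

theorem tsupport_dbar_subset (k : Fin n) (φ : (Fin n → ℂ) → ℂ) :
    tsupport (dbar k φ) ⊆ tsupport φ := by
  refine closure_minimal (fun z hz => ?_) (isClosed_tsupport _)
  by_contra h
  apply hz
  rw [notMem_tsupport_iff_eventuallyEq] at h
  rw [dbar_congr k h]
  exact dbar_const k 0 z

theorem dbar_eq_zero_of_notMem_tsupport {φ : (Fin n → ℂ) → ℂ} {z : Fin n → ℂ} (k : Fin n)
    (hz : z ∉ tsupport φ) : dbar k φ z = 0 :=
  image_eq_zero_of_notMem_tsupport fun h => hz (tsupport_dbar_subset k φ h)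

namespace IsTestFunction

variable {Ω : Set (Fin n → ℂ)} {φ ψ : (Fin n → ℂ) → ℂ}

theorem dbar (h : IsTestFunction Ω φ) (k : Fin n) : IsTestFunction Ω (dbar k φ) :=
  ⟨contDiff_dbar h.1 k, h.2.1.mono' ((subset_tsupport _).trans (tsupport_dbar_subset k φ)),
    (tsupport_dbar_subset k φ).trans h.2.2⟩

theorem mul_left (h : IsTestFunction Ω φ) (hψ : ContDiff ℝ ∞ ψ) :
    IsTestFunction Ω (fun z => ψ z * φ z) :=
  ⟨hψ.mul h.1, h.2.1.mul_left, (tsupport_mul_subset_right (f := ψ)).trans h.2.2⟩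

theorem integrable (h : IsTestFunction Ω φ) (μ : Measure (Fin n → ℂ))
    [IsFiniteMeasureOnCompacts μ] : Integrable φ μ :=
  h.1.continuous.integrable_of_hasCompactSupport h.2.1

theorem integrable_mul (h : IsTestFunction Ω φ) {f : (Fin n → ℂ) → ℂ}
    {μ : Measure (Fin n → ℂ)} [IsFiniteMeasureOnCompacts μ] (hf : MemLp f ∞ μ) :
    Integrable (fun z => f z * φ z) μ :=
  (h.integrable μ).mul_of_top_right hf

end IsTestFunction

/-- A continuous function times an essentially bounded function on a bounded set is essentially
bounded. -/
theorem memLp_top_continuous_mul {Ω : Set (Fin n → ℂ)} (hb : Bornology.IsBounded Ω)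
    (hm : MeasurableSet Ω)
    {ψ f : (Fin n → ℂ) → ℂ} (hψ : Continuous ψ) (hf : MemLp f ∞ (volume.restrict Ω)) :
    MemLp (fun z => ψ z * f z) ∞ (volume.restrict Ω) := by
  obtain ⟨C, hC⟩ := hb.isCompact_closure.exists_bound_of_continuousOn hψ.continuousOn
  have h1 : MemLp ψ ∞ (volume.restrict Ω) :=
    memLp_top_of_bound hψ.aestronglyMeasurable C
      ((ae_restrict_iff' hm).2 (Filter.Eventually.of_forall fun z hz => hC z (subset_closure hz)))
  exact hf.mul' h1

end

/-! ### Weak ∂̄-calculus for bounded forms -/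

section

variable {n s : ℕ} {Ω : Set (Fin n → ℂ)}

/-- For k < l, erasing k lowers the number of indices below l by one, while erasing l leaves those
below k unchanged. This single sign is what makes ∂̄ ∘ ∂̄ vanish. -/
theorem neg_one_pow_card_filter_erase_comm (K : Finset (Fin n)) {k l : Fin n} (hk : k ∈ K)
    (hl : l ∈ K) (hkl : k ≠ l) :
    (-1 : ℂ) ^ (K.filter (fun j => j < k)).card *
        (-1) ^ ((K.erase k).filter (fun j => j < l)).card =
      -((-1) ^ (K.filter (fun j => j < l)).card *
        (-1) ^ ((K.erase l).filter (fun j => j < k)).card) := by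
  wlog h : k < l generalizing k l
  · have := this hl hk hkl.symm (lt_of_le_of_ne (not_lt.1 h) hkl.symm)
    rw [this, neg_neg]
  have h1 : (K.erase l).filter (fun j => j < k) = K.filter (fun j => j < k) := by
    ext j; simp only [Finset.mem_filter, Finset.mem_erase]
    exact ⟨fun hj => ⟨hj.1.2, hj.2⟩, fun hj => ⟨⟨(hj.2.trans h).ne, hj.1⟩, hj.2⟩⟩
  have h2 : (K.filter (fun j => j < l)).card = ((K.erase k).filter (fun j => j < l)).card + 1 := by
    rw [Finset.filter_erase, Finset.card_erase_add_one]
    simp [hk, h]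
  rw [h1, h2, pow_succ]
  ring

/-- The coefficient of a form at an arbitrary finite set, zero if the cardinality is wrong. -/
def ZeroForm.extend (f : ZeroForm n s) (J : Finset (Fin n)) (z : Fin n → ℂ) : ℂ :=
  if h : J.card = s then f ⟨J, h⟩ z else 0

theorem ZeroForm.extend_coe (f : ZeroForm n s) (J : MultiIndex n s) : f.extend J.1 = f J := by
  funext z
  simp [ZeroForm.extend, J.2]

/-- `∂̄ ∘ ∂̄ = 0` for weak derivatives. -/
theorem WeakDbarEq.isClosed {f : ZeroForm n s} {h : ZeroForm n (s + 1)}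
    (hfh : WeakDbarEq Ω f h) : WeakDbarEq Ω h 0 := by
  intro K φ hφ
  -- `T k l` is the contribution of removing k and then l. Using `extend` keeps cardinality proofs
  -- out of the term, so the order of removal can be rewritten.
  set T : Fin n → Fin n → ℂ := fun k l =>
    (-1 : ℂ) ^ (K.1.filter (fun j => j < k)).card *
      (-1) ^ ((K.1.erase k).filter (fun j => j < l)).card *
      ∫ z in Ω, f.extend ((K.1.erase k).erase l) z * dbar l (dbar k φ) z with hT
  have key : ∀ k : {k // k ∈ K.1}, K.sign k.1 * ∫ z in Ω, h (K.remove k) z * dbar k.1 φ z =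
      -∑ l ∈ K.1.erase k.1, T k.1 l := by
    intro k
    have := hfh (K.remove k) (dbar k.1 φ) (hφ.dbar k.1)
    rw [← neg_eq_iff_eq_neg] at this
    rw [← this, mul_neg, Finset.mul_sum]
    congr 1
    rw [← Finset.sum_coe_sort (K.1.erase k.1)]
    refine Finset.sum_congr rfl fun l _ => ?_
    rw [hT, ← mul_assoc, ← f.extend_coe]
    rfl
  rw [Finset.sum_congr rfl fun k _ => key k, Finset.sum_coe_sort K.1
    (fun k => -∑ l ∈ K.1.erase k, T k l), Finset.sum_neg_distrib]
  -- Signs are antisymmetric in k and l, mixed derivatives of φ are symmetric; the double sum equals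
  -- its own negative.
  have hanti : ∑ k ∈ K.1, ∑ l ∈ K.1.erase k, T k l = -∑ k ∈ K.1, ∑ l ∈ K.1.erase k, T k l := by
    conv_lhs => rw [Finset.sum_comm' (t' := K.1) (s' := fun l => K.1.erase l)
      (by intro x y; simp only [Finset.mem_erase]; tauto)]
    rw [← Finset.sum_neg_distrib]
    refine Finset.sum_congr rfl fun k hk => ?_
    rw [← Finset.sum_neg_distrib]
    refine Finset.sum_congr rfl fun l hl => ?_
    rw [Finset.mem_erase] at hl
    simp only [hT]
    rw [neg_one_pow_card_filter_erase_comm K.1 hl.2 hk hl.1, Finset.erase_right_comm]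
    simp_rw [fun z => dbar_comm hφ.1 k l z]
    ring
  have : ∑ k ∈ K.1, ∑ l ∈ K.1.erase k, T k l = 0 := by
    linear_combination (1 / 2 : ℂ) * hanti
  simp [this]

theorem IsLInftyForm.sum {ι : Type*} [Fintype ι] {f : ι → ZeroForm n s}
    (hf : ∀ b, IsLInftyForm Ω (f b)) : IsLInftyForm Ω (fun J z => ∑ b, f b J z) := fun J =>
  memLp_finsetSum _ fun b _ => hf b J

theorem WeakDbarEq.sum {ι : Type*} [Fintype ι] {f : ι → ZeroForm n s} {h : ι → ZeroForm n (s + 1)}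
    (hf : ∀ b, IsLInftyForm Ω (f b)) (hh : ∀ b, IsLInftyForm Ω (h b))
    (H : ∀ b, WeakDbarEq Ω (f b) (h b)) :
    WeakDbarEq Ω (fun J z => ∑ b, f b J z) (fun K z => ∑ b, h b K z) := by
  intro K φ hφ
  simp_rw [Finset.sum_mul]
  rw [integral_finsetSum _ fun b _ => hφ.integrable_mul (hh b K), ← Finset.sum_neg_distrib,
    ← Finset.sum_congr rfl fun b _ => H b K φ hφ, Finset.sum_comm]
  refine Finset.sum_congr rfl fun k _ => ?_
  rw [integral_finsetSum _ fun b _ => (hφ.dbar k.1).integrable_mul (hf b _), Finset.mul_sum]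

theorem WeakDbarEq.sub {f f' : ZeroForm n s} {h h' : ZeroForm n (s + 1)}
    (hf : IsLInftyForm Ω f) (hf' : IsLInftyForm Ω f') (hh : IsLInftyForm Ω h)
    (hh' : IsLInftyForm Ω h') (H : WeakDbarEq Ω f h) (H' : WeakDbarEq Ω f' h') :
    WeakDbarEq Ω (f - f') (h - h') := by
  intro K φ hφ
  simp only [Pi.sub_apply, sub_mul]
  rw [integral_sub (hφ.integrable_mul (hh K)) (hφ.integrable_mul (hh' K)), neg_sub', ← H K φ hφ,
    ← H' K φ hφ, ← Finset.sum_sub_distrib]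
  refine Finset.sum_congr rfl fun k _ => ?_
  rw [integral_sub ((hφ.dbar k.1).integrable_mul (hf _)) ((hφ.dbar k.1).integrable_mul (hf' _)),
    mul_sub]

/-- The form `∂̄ψ ∧ f`. -/
def dbarWedge (ψ : (Fin n → ℂ) → ℂ) (f : ZeroForm n s) : ZeroForm n (s + 1) := fun K z =>
  ∑ k : {k : Fin n // k ∈ K.1}, K.sign k.1 * (dbar k.1 ψ z * f (K.remove k) z)

theorem IsLInftyForm.continuous_mul (hb : Bornology.IsBounded Ω) (hm : MeasurableSet Ω)
    {ψ : (Fin n → ℂ) → ℂ} (hψ : Continuous ψ) {f : ZeroForm n s} (hf : IsLInftyForm Ω f) :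
    IsLInftyForm Ω (fun J z => ψ z * f J z) := fun J =>
  memLp_top_continuous_mul hb hm hψ (hf J)

theorem IsLInftyForm.dbarWedge (hb : Bornology.IsBounded Ω) (hm : MeasurableSet Ω)
    {ψ : (Fin n → ℂ) → ℂ} (hψ : ContDiff ℝ ∞ ψ) {f : ZeroForm n s} (hf : IsLInftyForm Ω f) :
    IsLInftyForm Ω (dbarWedge ψ f) := fun K => by
  refine memLp_finsetSum _ fun k _ => ?_
  exact (memLp_top_continuous_mul hb hm (contDiff_dbar hψ k.1).continuous
    (hf (K.remove k))).const_mul _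

theorem IsLInftyForm.add {f h : ZeroForm n s} (hf : IsLInftyForm Ω f) (hh : IsLInftyForm Ω h) :
    IsLInftyForm Ω (fun J z => f J z + h J z) := fun J => (hf J).add (hh J)

theorem IsLInftyForm.zero : IsLInftyForm Ω (0 : ZeroForm n s) := fun _ => MemLp.zero

/-- The Leibniz rule `∂̄(ψ f) = ψ ∂̄f + ∂̄ψ ∧ f`. -/
theorem WeakDbarEq.smooth_mul (hb : Bornology.IsBounded Ω) (hm : MeasurableSet Ω)
    {ψ : (Fin n → ℂ) → ℂ} (hψ : ContDiff ℝ ∞ ψ)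
    {f : ZeroForm n s} {h : ZeroForm n (s + 1)} (hf : IsLInftyForm Ω f) (hh : IsLInftyForm Ω h)
    (H : WeakDbarEq Ω f h) :
    WeakDbarEq Ω (fun J z => ψ z * f J z) (fun K z => ψ z * h K z + dbarWedge ψ f K z) := by
  intro K φ hφ
  -- The derivative is moved onto ψφ, again a test function, so that the hypothesis on f applies to
  -- it.
  have e1 : ∀ k : {k : Fin n // k ∈ K.1},
      ∫ z in Ω, ψ z * f (K.remove k) z * dbar k.1 φ z =
      (∫ z in Ω, f (K.remove k) z * dbar k.1 (fun z => ψ z * φ z) z) -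
        ∫ z in Ω, dbar k.1 ψ z * f (K.remove k) z * φ z := by
    intro k
    rw [← integral_sub (((hφ.mul_left hψ).dbar k.1).integrable_mul (hf _))
      (hφ.integrable_mul (memLp_top_continuous_mul hb hm (contDiff_dbar hψ k.1).continuous (hf _)))]
    refine integral_congr_ae (Filter.Eventually.of_forall fun z => ?_)
    simp only
    rw [dbar_mul k.1 (hψ.differentiable (by simp) z) (hφ.1.differentiable (by simp) z)]
    ring
  have e2 : ∫ z in Ω, dbarWedge ψ f K z * φ z = ∑ k : {k : Fin n // k ∈ K.1},
      K.sign k.1 * ∫ z in Ω, dbar k.1 ψ z * f (K.remove k) z * φ z := by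
    simp only [dbarWedge, Finset.sum_mul]
    rw [integral_finsetSum]
    · refine Finset.sum_congr rfl fun k _ => ?_
      rw [← integral_const_mul]
      simp only [mul_assoc]
    · intro k _
      exact hφ.integrable_mul ((memLp_top_continuous_mul hb hm
        (contDiff_dbar hψ k.1).continuous (hf _)).const_mul _)
  have e3 : ∫ z in Ω, (ψ z * h K z + dbarWedge ψ f K z) * φ z =
      (∫ z in Ω, h K z * (ψ z * φ z)) + ∫ z in Ω, dbarWedge ψ f K z * φ z := by
    rw [← integral_add ((hφ.mul_left hψ).integrable_mul (hh K))
      (hφ.integrable_mul (hf.dbarWedge hb hm hψ K))]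
    congr 1
    funext z
    ring
  rw [e3, e2, neg_add, ← H K _ (hφ.mul_left hψ), ← Finset.sum_neg_distrib,
    ← Finset.sum_add_distrib]
  refine Finset.sum_congr rfl fun k _ => ?_
  rw [e1 k]
  ring

variable {ι : Type*} [Fintype ι]

/-- A matrix of functions acting on a vector of forms. -/
def mulForm (M : (Fin n → ℂ) → Matrix ι ι ℂ) (c : ι → ZeroForm n s) : ι → ZeroForm n s :=
  fun a J z => ∑ b, M z a b * c b J z

/-- `∂̄M ∧ c` for a matrix `M` of functions and a vector `c` of forms. -/
def dbarMulForm (M : (Fin n → ℂ) → Matrix ι ι ℂ) (c : ι → ZeroForm n s) : ι → ZeroForm n (s + 1) :=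
  fun a K z => ∑ b, dbarWedge (fun z => M z a b) (c b) K z

theorem isLInftyForm_mulForm (hb : Bornology.IsBounded Ω) (hm : MeasurableSet Ω)
    {M : (Fin n → ℂ) → Matrix ι ι ℂ} (hM : ∀ a b, ContDiff ℝ ∞ fun z => M z a b)
    {c : ι → ZeroForm n s} (hc : ∀ a, IsLInftyForm Ω (c a)) (a : ι) :
    IsLInftyForm Ω (mulForm M c a) :=
  IsLInftyForm.sum fun b => (hc b).continuous_mul hb hm (hM a b).continuous

theorem isLInftyForm_dbarMulForm (hb : Bornology.IsBounded Ω) (hm : MeasurableSet Ω)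
    {M : (Fin n → ℂ) → Matrix ι ι ℂ} (hM : ∀ a b, ContDiff ℝ ∞ fun z => M z a b)
    {c : ι → ZeroForm n s} (hc : ∀ a, IsLInftyForm Ω (c a)) (a : ι) :
    IsLInftyForm Ω (dbarMulForm M c a) :=
  IsLInftyForm.sum fun b => (hc b).dbarWedge hb hm (hM a b)

theorem weakDbarEq_mulForm (hb : Bornology.IsBounded Ω) (hm : MeasurableSet Ω)
    {M : (Fin n → ℂ) → Matrix ι ι ℂ} (hM : ∀ a b, ContDiff ℝ ∞ fun z => M z a b)
    {c : ι → ZeroForm n s} {h : ι → ZeroForm n (s + 1)} (hc : ∀ a, IsLInftyForm Ω (c a))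
    (hh : ∀ a, IsLInftyForm Ω (h a)) (H : ∀ a, WeakDbarEq Ω (c a) (h a)) (a : ι) :
    WeakDbarEq Ω (mulForm M c a) (fun K z => mulForm M h a K z + dbarMulForm M c a K z) := by
  have := WeakDbarEq.sum (fun b => (hc b).continuous_mul hb hm (hM a b).continuous)
    (fun b => ((hh b).continuous_mul hb hm (hM a b).continuous).add
      ((hc b).dbarWedge hb hm (hM a b)))
    (fun b => (H b).smooth_mul hb hm (hM a b) (hc b) (hh b))
  simp only [Finset.sum_add_distrib] at this
  exact this

theorem weakDbarEq_mulForm_of_closed (hb : Bornology.IsBounded Ω) (hm : MeasurableSet Ω)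
    {M : (Fin n → ℂ) → Matrix ι ι ℂ} (hM : ∀ a b, ContDiff ℝ ∞ fun z => M z a b)
    {c : ι → ZeroForm n s} (hc : ∀ a, IsLInftyForm Ω (c a))
    (H : ∀ a, WeakDbarEq Ω (c a) 0) (a : ι) :
    WeakDbarEq Ω (mulForm M c a) (dbarMulForm M c a) := by
  have := weakDbarEq_mulForm hb hm hM hc (h := fun _ => 0) (fun _ => IsLInftyForm.zero) H a
  simpa [mulForm] using this

/-- The Leibniz term ∂̄M ∧ c drops out, so M commutes with ∂̄. This is used for the Koszul
differential. -/
theorem weakDbarEq_mulForm_of_holomorphic (hb : Bornology.IsBounded Ω) (hm : MeasurableSet Ω)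
    {M : (Fin n → ℂ) → Matrix ι ι ℂ} (hM : ∀ a b, ContDiff ℝ ∞ fun z => M z a b)
    (hM' : ∀ a b k z, dbar k (fun z => M z a b) z = 0)
    {c : ι → ZeroForm n s} {h : ι → ZeroForm n (s + 1)} (hc : ∀ a, IsLInftyForm Ω (c a))
    (hh : ∀ a, IsLInftyForm Ω (h a)) (H : ∀ a, WeakDbarEq Ω (c a) (h a)) (a : ι) :
    WeakDbarEq Ω (mulForm M c a) (mulForm M h a) := by
  have := weakDbarEq_mulForm hb hm hM hc hh H a
  simpa [dbarMulForm, dbarWedge, hM'] using this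

end

/-! ### Anticommutation relations and the descent through the double complex -/

section

/-- Matrices satisfying the anticommutation relations of contraction and exterior multiplication
by the standard basis on the exterior algebra of `ℂⁿ`, with `e` in the role of the unit. -/
theorem exists_clifford_matrices (n : ℕ) : ∃ (ι : Type) (_ : Fintype ι) (_ : DecidableEq ι)
    (E F : Fin n → Matrix ι ι ℂ) (e : ι → ℂ) (a : ι),
    (∀ i j, E i * E j + E j * E i = 0) ∧
    (∀ i j, E i * F j + F j * E i = if i = j then 1 else 0) ∧
    (∀ i, (E i).mulVec e = 0) ∧ e a = 1 := by
  induction n with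
  | zero => exact ⟨Unit, inferInstance, inferInstance, Fin.elim0, Fin.elim0, 1, (),
      fun i => i.elim0, fun i => i.elim0, fun i => i.elim0, rfl⟩
  | succ n ih =>
    obtain ⟨ι, _, _, E, F, e, a, hE, hF, he, ha⟩ := ih
    -- Λ(ℂⁿ⁺¹) = Λ ⊕ f ∧ Λ with Λ = Λ(ℂⁿ): contraction with the new vector f maps the second summand
    -- to the first, multiplication by f maps back, and the old operators change sign on the second
    -- summand because they must pass f.
    refine ⟨ι ⊕ ι, inferInstance, inferInstance,
      Fin.cons (Matrix.fromBlocks 0 1 0 0) fun i => Matrix.fromBlocks (E i) 0 0 (-E i),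
      Fin.cons (Matrix.fromBlocks 0 0 1 0) fun i => Matrix.fromBlocks (F i) 0 0 (-F i),
      Sum.elim e 0, Sum.inl a, ?_, ?_, ?_, ha⟩
    · intro i j
      cases i using Fin.cases <;> cases j using Fin.cases <;>
        simp [Matrix.fromBlocks_multiply, Matrix.fromBlocks_add, hE]
    · intro i j
      cases i using Fin.cases <;> cases j using Fin.cases <;>
        simp [Matrix.fromBlocks_multiply, Matrix.fromBlocks_add, hF, Fin.succ_ne_zero,
          (Fin.succ_ne_zero _).symm]
      split_ifs <;> simp [Matrix.fromBlocks_one]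
    · intro i
      cases i using Fin.cases <;> simp [Matrix.fromBlocks_mulVec, he]

section Clifford

variable {n : ℕ} {ι : Type*} [Fintype ι] [DecidableEq ι] {E F : Fin n → Matrix ι ι ℂ}

/-- The coefficients x_i x_j are symmetric and the products of the `E i` antisymmetric. -/
theorem clifford_sq_eq_zero (hE : ∀ i j, E i * E j + E j * E i = 0) (x : Fin n → ℂ) :
    (∑ j, x j • E j) * (∑ j, x j • E j) = 0 := by
  have h : (∑ j, x j • E j) * (∑ j, x j • E j) =
      -((∑ j, x j • E j) * (∑ j, x j • E j)) := by
    simp only [Finset.sum_mul_sum]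
    conv_lhs => rw [Finset.sum_comm]
    rw [← Finset.sum_neg_distrib]
    refine Finset.sum_congr rfl fun i _ => ?_
    rw [← Finset.sum_neg_distrib]
    refine Finset.sum_congr rfl fun j _ => ?_
    simp only [smul_mul_smul_comm]
    rw [eq_neg_of_add_eq_zero_left (hE j i), smul_neg, mul_comm]
  ext a b
  simpa using self_eq_neg.1 (congrFun (congrFun h a) b)

/-- With x = z - a, the choice y = ξ gives the homotopy identity for P and X, and y = ∂̄_k ξ gives
the anticommutation of P with ∂̄_k X. -/
theorem clifford_mul_add_mul (hF : ∀ i j, E i * F j + F j * E i = if i = j then 1 else 0)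
    (x y : Fin n → ℂ) :
    (∑ j, x j • E j) * (∑ j, y j • F j) + (∑ j, y j • F j) * (∑ j, x j • E j) =
      (∑ j, x j * y j) • 1 := by
  have h : (∑ j, y j • F j) * (∑ j, x j • E j) =
      ∑ i, ∑ j, (x i • E i) * (y j • F j) + ∑ i, ∑ j, (y j • F j) * (x i • E i)
        - ∑ i, ∑ j, (x i • E i) * (y j • F j) := by
    rw [Finset.sum_mul_sum, Finset.sum_comm]
    abel
  rw [h, Finset.sum_mul_sum, ← Finset.sum_add_distrib, add_sub_cancel, Finset.sum_smul]
  refine Finset.sum_congr rfl fun i _ => ?_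
  rw [← Finset.sum_add_distrib]
  have : ∀ j, (x i • E i) * (y j • F j) + (y j • F j) * (x i • E i) =
      if i = j then (x i * y j) • (1 : Matrix ι ι ℂ) else 0 := by
    intro j
    rw [smul_mul_smul_comm, smul_mul_smul_comm, mul_comm (y j), ← smul_add, hF]
    split_ifs <;> simp
  rw [Finset.sum_congr rfl fun j _ => this j]
  simp

end Clifford

variable {n s : ℕ} {Ω : Set (Fin n → ℂ)} {ι : Type*} [Fintype ι]

theorem mulForm_apply (M : (Fin n → ℂ) → Matrix ι ι ℂ) (c : ι → ZeroForm n s) (J : MultiIndex n s)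
    (z : Fin n → ℂ) : (fun a => mulForm M c a J z) = (M z).mulVec fun b => c b J z := rfl

/-- The coefficientwise `∂̄_k`-derivative of a matrix of functions. -/
def dbarMatrix (k : Fin n) (M : (Fin n → ℂ) → Matrix ι ι ℂ) (z : Fin n → ℂ) : Matrix ι ι ℂ :=
  Matrix.of fun a b => dbar k (fun z => M z a b) z

theorem dbarMulForm_apply (M : (Fin n → ℂ) → Matrix ι ι ℂ) (c : ι → ZeroForm n s)
    (K : MultiIndex n (s + 1)) (z : Fin n → ℂ) : (fun a => dbarMulForm M c a K z) =
      ∑ k : {k : Fin n // k ∈ K.1}, K.sign k.1 •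
        (dbarMatrix k.1 M z).mulVec fun b => c b (K.remove k) z := by
  funext a
  simp only [dbarMulForm, dbarWedge, Finset.sum_apply, Pi.smul_apply, Matrix.mulVec, dotProduct,
    smul_eq_mul, dbarMatrix, Matrix.of_apply, Finset.mul_sum]
  rw [Finset.sum_comm]

variable [DecidableEq ι]

/-- Solving `∂̄w = b`, `P w = 0` with bounds, for a `∂̄`-closed and `P`-closed `b` supported in
the set where `Ξ` is a homotopy for `P`. -/
theorem exists_weakDbarEq_mulForm_eq_zero (hb : Bornology.IsBounded Ω) (hm : MeasurableSet Ω)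
    (hsolv : ∀ (s : ℕ) (β : ZeroForm n (s + 1)), IsLInftyForm Ω β → WeakDbarEq Ω β 0 →
      ∃ α : ZeroForm n s, IsLInftyForm Ω α ∧ WeakDbarEq Ω α β)
    {P X : (Fin n → ℂ) → Matrix ι ι ℂ} {A : Set (Fin n → ℂ)}
    (hP : ∀ a b, ContDiff ℝ ∞ fun z => P z a b)
    (hP' : ∀ a b k z, dbar k (fun z => P z a b) z = 0) (hPP : ∀ z, P z * P z = 0)
    (hX : ∀ a b, ContDiff ℝ ∞ fun z => X z a b)
    (hPX : ∀ z ∈ A, P z * X z + X z * P z = 1)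
    (hPX' : ∀ z ∈ A, ∀ k, P z * dbarMatrix k X z + dbarMatrix k X z * P z = 0) :
    ∀ m s : ℕ, n ≤ s + m → ∀ b : ι → ZeroForm n (s + 1), (∀ a, IsLInftyForm Ω (b a)) →
      (∀ a, WeakDbarEq Ω (b a) 0) → mulForm P b = 0 →
      (∀ z, z ∉ A → ∀ a J, b a J z = 0) →
      ∃ w : ι → ZeroForm n s, (∀ a, IsLInftyForm Ω (w a)) ∧ (∀ a, WeakDbarEq Ω (w a) (b a)) ∧
        mulForm P w = 0 := by
  intro m
  induction m with
  | zero =>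
    -- Here s + 1 > n, so there are no multi-indices and nothing to prove.
    intro s hs b _ _ _ _
    refine ⟨0, fun _ => IsLInftyForm.zero, fun a K => ?_, ?_⟩
    · have := K.2 ▸ K.1.card_le_univ
      simp at this
      omega
    · funext a J z
      simp [mulForm]
  | succ m ih =>
    intro s hs b hbL hbc hPb hbA
    have hPb' : ∀ J z, (P z).mulVec (fun a => b a J z) = 0 := fun J z => by
      rw [← mulForm_apply, hPb]; rfl
    have hv := weakDbarEq_mulForm_of_closed hb hm hX hbL hbc
    have hvL := isLInftyForm_mulForm hb hm hX hbL
    have hb'L := isLInftyForm_dbarMulForm hb hm hX hbL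
    -- ∂̄X ∧ b = ∂̄(Xb) inherits every hypothesis: it is closed as a ∂̄, P-closed because P
    -- anticommutes with ∂̄_k X on A and P b = 0, and it vanishes wherever b does.
    obtain ⟨w', hw'L, hw', hPw'⟩ := ih (s + 1) (by omega) (dbarMulForm X b) hb'L
      (fun a => (hv a).isClosed) (by
        funext a K z
        refine congrFun (?_ : (fun a => mulForm P (dbarMulForm X b) a K z) = 0) a
        rw [mulForm_apply, dbarMulForm_apply, Matrix.mulVec_sum]
        refine Finset.sum_eq_zero fun k _ => ?_
        rw [Matrix.mulVec_smul, Matrix.mulVec_mulVec]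
        by_cases hz : z ∈ A
        · rw [eq_neg_of_add_eq_zero_left (hPX' z hz k.1), Matrix.neg_mulVec,
            ← Matrix.mulVec_mulVec, hPb']
          simp
        · rw [show (fun a => b a (K.remove k) z) = 0 from funext fun a => hbA z hz a _]
          simp)
      (by
        intro z hz a J
        simp [dbarMulForm, dbarWedge, hbA z hz])
    have hd : ∀ a, IsLInftyForm Ω (mulForm X b a - w' a) := fun a J => (hvL a J).sub (hw'L a J)
    have hclosed : ∀ a, WeakDbarEq Ω (mulForm X b a - w' a) 0 := fun a => by
      simpa using (hv a).sub (hvL a) (hw'L a) (hb'L a) (hb'L a) (hw' a)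
    choose y hyL hy using fun a => hsolv s (mulForm X b a - w' a) (hd a) (hclosed a)
    -- ∂̄(Py) = P ∂̄y = PXb - Pw' = PXb. On A this is b - XPb = b; off A both sides vanish.
    refine ⟨mulForm P y, isLInftyForm_mulForm hb hm hP hyL, fun a => ?_, ?_⟩
    · have := weakDbarEq_mulForm_of_holomorphic hb hm hP hP' hyL hd hy a
      convert this using 1
      funext J z
      refine congrFun (?_ : (fun a => b a J z) =
        fun a => mulForm P (fun a => mulForm X b a - w' a) a J z) a
      rw [mulForm_apply]
      have e1 : (fun a => (mulForm X b a - w' a) J z) =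
          (X z).mulVec (fun a => b a J z) - fun a => w' a J z := rfl
      have e2 : (P z).mulVec (fun a => w' a J z) = 0 := by
        rw [← mulForm_apply, hPw']; rfl
      rw [e1, Matrix.mulVec_sub, e2, sub_zero]
      by_cases hz : z ∈ A
      · rw [Matrix.mulVec_mulVec, eq_sub_of_add_eq (hPX z hz), Matrix.sub_mulVec,
          ← Matrix.mulVec_mulVec, hPb']
        simp
      · rw [show (fun a => b a J z) = 0 from funext fun a => hbA z hz a _]
        simp
    · funext a J z
      refine congrFun (?_ : (fun a => mulForm P (mulForm P y) a J z) = 0) a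
      rw [mulForm_apply, mulForm_apply, Matrix.mulVec_mulVec, hPP, Matrix.zero_mulVec]

end

/-! ### Cauchy–Riemann equations, mean values and smoothness -/

section

variable {n : ℕ}

/-- Vanishing of ∂̄_k says that the real derivative along i e_k is i times the one along e_k, which
makes the derivative complex linear. -/
theorem differentiableAt_of_dbar_eq_zero {φ : (Fin n → ℂ) → ℂ} {z : Fin n → ℂ}
    (hφ : DifferentiableAt ℝ φ z) (h : ∀ k, dbar k φ z = 0) : DifferentiableAt ℂ φ z := by
  rw [differentiableAt_iff_restrictScalars ℝ hφ]
  refine ⟨∑ k, (ContinuousLinearMap.proj (R := ℂ) (φ := fun _ : Fin n => ℂ) k).smulRight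
    (fderiv ℝ φ z (Pi.single k 1)), ?_⟩
  ext v
  have hv : v = ∑ k, ((v k).re • (Pi.single k 1 : Fin n → ℂ) +
      (v k).im • (Pi.single k Complex.I : Fin n → ℂ)) := by
    conv_lhs => rw [← Finset.univ_sum_single v]
    refine Finset.sum_congr rfl fun k _ => ?_
    rw [← Pi.single_smul, ← Pi.single_smul, ← Pi.single_add]
    congr 1
    simp
  conv_rhs => rw [hv]
  rw [map_sum]
  simp only [ContinuousLinearMap.coe_restrictScalars', sum_apply,
    ContinuousLinearMap.smulRight_apply, ContinuousLinearMap.proj_apply]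
  refine Finset.sum_congr rfl fun k _ => ?_
  have hk := h k
  unfold dbar at hk
  have hI : fderiv ℝ φ z (Pi.single k Complex.I) =
      Complex.I * fderiv ℝ φ z (Pi.single k 1) := by
    linear_combination (-2 * Complex.I) * hk +
      fderiv ℝ φ z (Pi.single k Complex.I) * Complex.I_mul_I
  rw [map_add, map_smul, map_smul, hI]
  simp only [smul_eq_mul, Complex.real_smul]
  conv_lhs => rw [← Complex.re_add_im (v k)]
  ring

/-- A smooth mollifier invariant under the diagonal rotations. -/
structure IsRotationKernel (r : ℝ) (κ : (Fin n → ℂ) → ℂ) : Prop where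
  contDiff : ContDiff ℝ ∞ κ
  eq_zero : ∀ w, r ≤ ‖w‖ → κ w = 0
  integral : ∫ w, κ w = 1
  rotation : ∀ c : ℂ, ‖c‖ = 1 → ∀ w, κ (c • w) = κ w

theorem IsRotationKernel.hasCompactSupport {r : ℝ} {κ : (Fin n → ℂ) → ℂ}
    (h : IsRotationKernel r κ) : HasCompactSupport κ :=
  HasCompactSupport.intro (isCompact_closedBall 0 r) fun w hw =>
    h.eq_zero w (by simpa using (not_le.1 (fun h' => hw (by simpa using h'))).le)

theorem exists_isRotationKernel (n : ℕ) {r : ℝ} (hr : 0 < r) :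
    ∃ κ : (Fin n → ℂ) → ℂ, IsRotationKernel r κ := by
  -- The squared Euclidean norm is smooth and invariant under unit scalars. It dominates the squared
  -- sup norm, so `b` vanishes once r ≤ ‖w‖.
  set b : (Fin n → ℂ) → ℝ := fun w =>
    Real.smoothTransition (1 - (∑ j, ‖w j‖ ^ 2) / r ^ 2) with hbdef
  have hb : ContDiff ℝ ∞ b := by
    refine Real.smoothTransition.contDiff.comp (contDiff_const.sub (ContDiff.div_const ?_ _))
    refine ContDiff.sum fun j _ => ContDiff.norm_sq ℝ ?_
    exact contDiff_apply ℝ ℂ j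
  have hb0 : ∀ w, r ≤ ‖w‖ → b w = 0 := by
    intro w hw
    refine Real.smoothTransition.zero_of_nonpos ?_
    by_contra! hlt
    have h1 : ∑ j, ‖w j‖ ^ 2 < r ^ 2 := by
      have := (div_lt_one (by positivity)).1 (sub_pos.1 hlt)
      exact this
    refine absurd hw (not_le.2 ((pi_norm_lt_iff hr).2 fun i => ?_))
    have h2 : ‖w i‖ ^ 2 ≤ ∑ j, ‖w j‖ ^ 2 :=
      Finset.single_le_sum (f := fun j => ‖w j‖ ^ 2) (fun j _ => by positivity) (Finset.mem_univ i)
    exact lt_of_pow_lt_pow_left₀ 2 hr.le (h2.trans_lt h1)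
  have hcs : HasCompactSupport b := HasCompactSupport.intro (isCompact_closedBall 0 r) fun w hw =>
    hb0 w (by simpa using (not_le.1 (fun h' => hw (by simpa using h'))).le)
  have hpos : 0 < ∫ w, b w :=
    hb.continuous.integral_pos_of_hasCompactSupport_nonneg_nonzero hcs
      (fun w => Real.smoothTransition.nonneg _) (x := 0) (by simp [hbdef])
  refine ⟨fun w => ((∫ w, b w)⁻¹ * b w : ℝ), ?_, ?_, ?_, ?_⟩
  · exact Complex.ofRealCLM.contDiff.comp (contDiff_const.mul hb)
  · intro w hw
    simp [hb0 w hw]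
  · rw [integral_complex_ofReal, integral_const_mul, inv_mul_cancel₀ hpos.ne', Complex.ofReal_one]
  · intro c hc w
    simp [hbdef, hc]

theorem integral_comp_unit_smul (g : (Fin n → ℂ) → ℂ) {c : ℂ} (hc : ‖c‖ = 1) :
    ∫ w, g (c • w) = ∫ w, g w := by
  have hc0 : c ≠ 0 := by rintro rfl; simp at hc
  have h1 : MeasurePreserving (fun w : ℂ => c * w) := by
    have := (rotation ⟨c, mem_sphere_zero_iff_norm.2 hc⟩).measurePreserving
    convert this using 1
    rfl
  have h2 : MeasurePreserving (fun w : Fin n → ℂ => c • w) :=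
    volume_preserving_pi (fun _ : Fin n => h1)
  exact h2.integral_comp (measurableEmbedding_const_smul₀ hc0) g

/-- The mean value property of holomorphic functions for rotation invariant mollifiers. -/
theorem convolution_eq_of_differentiableOn {U : Set (Fin n → ℂ)} (hU : IsOpen U)
    {F : (Fin n → ℂ) → ℂ} (hF : DifferentiableOn ℂ F U) {r : ℝ}
    {κ : (Fin n → ℂ) → ℂ} (hκ : IsRotationKernel r κ) {z : Fin n → ℂ}
    (hz : Metric.closedBall z r ⊆ U) :
    convolution F κ (ContinuousLinearMap.mul ℝ ℂ) volume z = F z := by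
  rw [convolution_eq_swap]
  simp only [ContinuousLinearMap.mul_apply']
  set B : Set (Fin n → ℂ) := Metric.closedBall 0 r
  have hB : IsCompact B := isCompact_closedBall 0 r
  set H : ℝ → (Fin n → ℂ) → ℂ := fun θ w => F (z - circleMap 0 1 θ • w) * κ w
  have hnorm : ∀ θ, ‖circleMap 0 1 θ‖ = 1 := fun θ => by simp
  have hmem : ∀ w ∈ B, ∀ c : ℂ, ‖c‖ ≤ 1 → z - c • w ∈ U := by
    intro w hw c hc
    apply hz
    rw [mem_closedBall_iff_norm, sub_sub_cancel_left, norm_neg, norm_smul]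
    have : ‖w‖ ≤ r := by simpa [B] using hw
    calc ‖c‖ * ‖w‖ ≤ 1 * ‖w‖ := by gcongr
      _ ≤ r := by simpa
  have hzero : ∀ w ∉ B, κ w = 0 := fun w hw =>
    hκ.eq_zero w (by simpa using (not_le.1 (fun h' => hw (by simpa [B] using h'))).le)
  -- Each rotation by θ leaves the convolution integral unchanged. Averaging over θ and exchanging
  -- the integrals leaves the circle mean of F on a complex line through z, which is F z.
  have h1 : ∀ θ, ∫ w in B, H θ w = ∫ w, F (z - w) * κ w := by
    intro θ
    rw [setIntegral_eq_integral_of_forall_compl_eq_zero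
      (fun w hw => by simp only [H, hzero w hw, mul_zero]),
      ← integral_comp_unit_smul (fun w => F (z - w) * κ w) (hnorm θ)]
    simp only [H, hκ.rotation _ (hnorm θ)]
  have h2 : ∀ w ∈ B, ∫ θ in Set.Ioc 0 (2 * Real.pi), H θ w = 2 * Real.pi * F z * κ w := by
    intro w hw
    have hopen : IsOpen ((fun t : ℂ => z - t • w) ⁻¹' U) := hU.preimage (by fun_prop)
    have hd : DifferentiableOn ℂ (fun t : ℂ => F (z - t • w)) ((fun t : ℂ => z - t • w) ⁻¹' U) :=
      hF.comp (by fun_prop) fun t ht => ht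
    have hcl : closure (Metric.ball (0 : ℂ) |1|) ⊆ (fun t : ℂ => z - t • w) ⁻¹' U := by
      intro t ht
      have := Metric.closure_ball_subset_closedBall ht
      exact hmem w hw t (by simpa using this)
    have := (hd.mono hcl).diffContOnCl.circleAverage
    rw [Real.circleAverage, intervalIntegral.integral_of_le (by positivity)] at this
    simp only [H]
    rw [integral_mul_const]
    simp only [zero_smul, sub_zero, Complex.real_smul] at this
    rw [← this]
    push_cast
    field_simp
  have hint : Integrable (Function.uncurry H)
      ((volume.restrict (Set.Ioc 0 (2 * Real.pi))).prod (volume.restrict B)) := by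
    rw [Measure.prod_restrict]
    have hc : ContinuousOn (Function.uncurry H) (Set.Icc 0 (2 * Real.pi) ×ˢ B) := by
      refine ContinuousOn.mul ?_ (hκ.contDiff.continuous.comp continuous_snd).continuousOn
      refine hF.continuousOn.comp ?_ fun p hp => hmem p.2 hp.2 _ (hnorm p.1).le
      exact (continuous_const.sub
        (((continuous_circleMap 0 1).comp continuous_fst).smul continuous_snd)).continuousOn
    exact (hc.integrableOn_compact (isCompact_Icc.prod hB)).mono_set
      (Set.prod_mono Set.Ioc_subset_Icc_self subset_rfl)
  have h3 := integral_integral_swap hint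
  simp only [h1] at h3
  rw [setIntegral_congr_fun hB.measurableSet h2, integral_const_mul,
    setIntegral_eq_integral_of_forall_compl_eq_zero hzero, hκ.integral] at h3
  simp only [integral_const, MeasurableSet.univ, measureReal_restrict_apply, Set.univ_inter,
    Real.volume_real_Ioc, sub_zero, Complex.real_smul, mul_one] at h3
  rw [max_eq_left (by positivity)] at h3
  push_cast at h3
  exact mul_left_cancel₀ (by simp [Real.pi_ne_zero]) h3

/-- Near each point F coincides with its convolution against a smooth kernel. -/
theorem contDiffOn_of_differentiableOn {U : Set (Fin n → ℂ)} (hU : IsOpen U)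
    {F : (Fin n → ℂ) → ℂ} (hF : DifferentiableOn ℂ F U) : ContDiffOn ℝ ∞ F U := by
  intro z₀ hz₀
  obtain ⟨r, hr, hrU⟩ := Metric.isOpen_iff.1 hU z₀ hz₀
  obtain ⟨κ, hκ⟩ := exists_isRotationKernel n (half_pos (half_pos hr))
  have hc : IsCompact (Metric.closedBall z₀ (r / 2)) := isCompact_closedBall _ _
  have hsub : Metric.closedBall z₀ (r / 2) ⊆ U :=
    (Metric.closedBall_subset_ball (half_lt_self hr)).trans hrU
  have hI : Integrable ((Metric.closedBall z₀ (r / 2)).indicator F) :=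
    (hF.continuousOn.mono hsub |>.integrableOn_compact hc).integrable_indicator hc.measurableSet
  have hsm := hκ.hasCompactSupport.contDiff_convolution_right (ContinuousLinearMap.mul ℝ ℂ)
    hI.locallyIntegrable hκ.contDiff
  refine (hsm.contDiffAt.congr_of_eventuallyEq ?_).contDiffWithinAt
  filter_upwards [Metric.ball_mem_nhds z₀ (half_pos (half_pos hr))] with z hz
  have hsub' : Metric.closedBall z (r / 2 / 2) ⊆ Metric.ball z₀ (r / 2) := by
    intro w hw
    rw [Metric.mem_ball] at hz ⊢
    rw [Metric.mem_closedBall] at hw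
    linarith [dist_triangle w z z₀]
  rw [convolution_eq_of_differentiableOn Metric.isOpen_ball (U := Metric.ball z₀ (r / 2)) ?_ hκ hsub']
  · rw [Set.indicator_of_mem]
    exact Metric.ball_subset_closedBall (hsub' (Metric.mem_closedBall_self (by positivity)))
  · refine (hF.mono (Metric.ball_subset_closedBall.trans hsub)).congr fun w hw => ?_
    rw [Set.indicator_of_mem (Metric.ball_subset_closedBall hw)]

end

/-! ### Weyl's lemma for ∂̄ -/

section

variable {n : ℕ} {Ω : Set (Fin n → ℂ)}

/-- `f` is holomorphic on `Ω` in the sense of distributions. -/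
def IsWeaklyHolomorphicOn (f : (Fin n → ℂ) → ℂ) (Ω : Set (Fin n → ℂ)) : Prop :=
  ∀ k, ∀ φ : (Fin n → ℂ) → ℂ, IsTestFunction Ω φ → ∫ z in Ω, f z * dbar k φ z = 0

theorem dbar_comp_const_sub (k : Fin n) {κ : (Fin n → ℂ) → ℂ} (hκ : Differentiable ℝ κ)
    (z t : Fin n → ℂ) : dbar k (fun t => κ (z - t)) t = -dbar k κ (z - t) := by
  have h := ((hκ (z - t)).hasFDerivAt.comp t ((hasFDerivAt_id t).const_sub z)).fderiv
  have h' : fderiv ℝ (fun t => κ (z - t)) t = -fderiv ℝ κ (z - t) := by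
    refine h.trans ?_
    ext v
    simp
  unfold dbar
  rw [h']
  simp only [neg_apply]
  ring

theorem dbar_convolution {f κ : (Fin n → ℂ) → ℂ} (hf : LocallyIntegrable f)
    (hκ : ContDiff ℝ ∞ κ) (hc : HasCompactSupport κ) (k : Fin n) (z : Fin n → ℂ) :
    dbar k (convolution f κ (ContinuousLinearMap.mul ℝ ℂ) volume) z =
      ∫ t, f t * dbar k κ (z - t) := by
  have h := (hc.hasFDerivAt_convolution_right (ContinuousLinearMap.mul ℝ ℂ) hf
    (hκ.of_le (by simp)) z).fderiv
  have hex := (hc.fderiv (𝕜 := ℝ)).convolutionExists_right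
    ((ContinuousLinearMap.mul ℝ ℂ).precompR (Fin n → ℂ)) hf
    (hκ.continuous_fderiv (by simp)) z
  have key : ∀ v, fderiv ℝ (convolution f κ (ContinuousLinearMap.mul ℝ ℂ) volume) z v =
      ∫ t, f t * fderiv ℝ κ (z - t) v := by
    intro v
    rw [h, convolution_def, ContinuousLinearMap.integral_apply hex]
    rfl
  have hi : ∀ v, Integrable fun t => f t * fderiv ℝ κ (z - t) v := fun v =>
    (ContinuousLinearMap.apply ℝ ℂ v).integrable_comp hex
  unfold dbar
  rw [key, key, ← integral_const_mul, ← integral_add (hi _) ((hi _).const_mul _),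
    ← integral_const_mul]
  congr 1
  funext t
  ring

/-- Up to sign, ∂̄_k of the convolution at z is f tested against ∂̄_k of t ↦ κ(z - t), a test
function on Ω since the closed δ-ball about z lies in Ω. -/
theorem differentiableAt_convolution {f κ : (Fin n → ℂ) → ℂ} (hm : MeasurableSet Ω)
    (hf : LocallyIntegrable (Ω.indicator f)) (hw : IsWeaklyHolomorphicOn f Ω)
    (hκ : ContDiff ℝ ∞ κ) {δ : ℝ} (hδ : ∀ w, δ ≤ ‖w‖ → κ w = 0) {z : Fin n → ℂ}
    (hz : Metric.closedBall z δ ⊆ Ω) :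
    DifferentiableAt ℂ (convolution (Ω.indicator f) κ (ContinuousLinearMap.mul ℝ ℂ) volume) z := by
  have hc : HasCompactSupport κ :=
    HasCompactSupport.intro (isCompact_closedBall 0 δ) fun w hw =>
      hδ w (by simpa using (not_le.1 (fun h' => hw (by simpa using h'))).le)
  refine differentiableAt_of_dbar_eq_zero
    ((hc.contDiff_convolution_right _ hf hκ).differentiable (by simp) z) fun k => ?_
  rw [dbar_convolution hf hκ hc]
  have htest : IsTestFunction Ω (fun t => κ (z - t)) := by
    have hs : ∀ t ∉ Metric.closedBall z δ, κ (z - t) = 0 := fun t ht => by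
      refine hδ _ ?_
      rw [Metric.mem_closedBall, dist_eq_norm, not_le, norm_sub_rev] at ht
      exact ht.le
    refine ⟨hκ.comp (contDiff_const.sub contDiff_id),
      HasCompactSupport.intro (isCompact_closedBall z δ) hs, ?_⟩
    refine (closure_minimal (fun t ht => ?_) Metric.isClosed_closedBall).trans hz
    by_contra h
    exact ht (hs t h)
  have := hw k _ htest
  rw [← integral_indicator hm, ← neg_eq_zero, ← integral_neg] at this
  rw [← this]
  congr 1
  funext t
  rw [Set.indicator_mul_left, dbar_comp_const_sub k (hκ.differentiable (by simp))]
  ring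

/-- Locally, a weakly holomorphic function agrees almost everywhere with a holomorphic one. -/
theorem IsWeaklyHolomorphicOn.exists_local (ho : IsOpen Ω) {f : (Fin n → ℂ) → ℂ}
    (hf : LocallyIntegrable (Ω.indicator f)) (hw : IsWeaklyHolomorphicOn f Ω)
    {z₀ : Fin n → ℂ} (hz₀ : z₀ ∈ Ω) :
    ∃ r > 0, Metric.ball z₀ r ⊆ Ω ∧ ∃ G : (Fin n → ℂ) → ℂ,
      DifferentiableOn ℂ G (Metric.ball z₀ r) ∧ ∀ᵐ z, z ∈ Metric.ball z₀ r → f z = G z := by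
  obtain ⟨R, hR, hRΩ⟩ := Metric.isOpen_iff.1 ho z₀ hz₀
  -- Points at distance below 2r from z₀ then keep a closed ball of radius 2r inside Ω, leaving room
  -- for both mollifiers.
  set r := R / 4 with hr
  have hr0 : 0 < r := by positivity
  obtain ⟨κ, hκ⟩ := exists_isRotationKernel n hr0
  have hball : ∀ z ∈ Metric.ball z₀ (2 * r), ∀ δ ≤ 2 * r, Metric.closedBall z δ ⊆ Ω := by
    intro z hz δ hδ w hw
    apply hRΩ
    rw [Metric.mem_ball] at hz ⊢
    rw [Metric.mem_closedBall] at hw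
    linarith [dist_triangle w z z₀]
  have hsub : Metric.ball z₀ r ⊆ Metric.ball z₀ (2 * r) := Metric.ball_subset_ball (by linarith)
  have hrΩ : Metric.ball z₀ r ⊆ Ω := (Metric.ball_subset_ball (by linarith)).trans hRΩ
  refine ⟨r, hr0, hrΩ, convolution (Ω.indicator f) κ (ContinuousLinearMap.mul ℝ ℂ) volume,
    fun z hz => (differentiableAt_convolution ho.measurableSet hf hw hκ.contDiff hκ.eq_zero
      (hball z (hsub hz) r (by linarith))).differentiableWithinAt, ?_⟩
  let φ : ℕ → ContDiffBump (0 : Fin n → ℂ) := fun i =>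
    ⟨r / (i + 1) / 2, r / (i + 1), by positivity, half_lt_self (by positivity)⟩
  have hφ : Filter.Tendsto (fun i => (φ i).rOut) Filter.atTop (nhds 0) :=
    Filter.Tendsto.div_atTop tendsto_const_nhds
      (Filter.tendsto_atTop_add_const_right _ _ tendsto_natCast_atTop_atTop)
  have hφr : ∀ i, (φ i).rOut ≤ r := fun i =>
    div_le_self hr0.le (by linarith [(Nat.cast_nonneg i : (0 : ℝ) ≤ i)])
  have hae := ContDiffBump.ae_convolution_tendsto_right_of_locallyIntegrable (K := 2) hφ
    (Filter.Eventually.of_forall fun i => by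
      change r / (i + 1) ≤ 2 * (r / (i + 1) / 2)
      linarith) hf
  filter_upwards [hae] with z hz hzr
  rw [Set.indicator_of_mem (hrΩ hzr)] at hz
  -- The mollified φ_i ∗ f tends to f at almost every z. Being holomorphic near z, it is also
  -- reproduced by κ, so by associativity it equals φ_i ∗ (f ∗ κ) at z, which tends to (f ∗ κ)(z).
  refine tendsto_nhds_unique hz ?_
  have hcont : Continuous (convolution (Ω.indicator f) κ (ContinuousLinearMap.mul ℝ ℂ) volume) :=
    hκ.hasCompactSupport.continuous_convolution_right _ hf hκ.contDiff.continuous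
  have hlim := ContDiffBump.convolution_tendsto_right_of_continuous (μ := volume) hφ hcont z
  refine hlim.congr fun i => ?_
  have hκn : HasCompactSupport fun x => ‖κ x‖ := hκ.hasCompactSupport.norm
  rw [← convolution_assoc (ContinuousLinearMap.lsmul ℝ ℝ) (ContinuousLinearMap.mul ℝ ℂ)
    (ContinuousLinearMap.lsmul ℝ ℝ) (ContinuousLinearMap.mul ℝ ℂ)
    (fun x y z => by simp [mul_assoc]) (φ i).continuous_normed.aestronglyMeasurable
    hf.aestronglyMeasurable hκ.contDiff.continuous.aestronglyMeasurable
    (Filter.Eventually.of_forall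
      ((φ i).hasCompactSupport_normed.convolutionExists_left _ (φ i).continuous_normed hf))
    (Filter.Eventually.of_forall
      (hκn.convolutionExists_right _ (fun x => (hf x).norm) hκ.contDiff.continuous.norm))
    (HasCompactSupport.convolutionExists_left _ (φ i).hasCompactSupport_normed.norm
      (φ i).continuous_normed.norm
      (hκn.continuous_convolution_right _ (fun x => (hf x).norm) hκ.contDiff.continuous.norm).locallyIntegrable _)]
  refine convolution_eq_of_differentiableOn (U := Metric.ball z₀ (2 * r)) Metric.isOpen_ball ?_ hκ ?_
  · have e : convolution ((φ i).normed volume) (Ω.indicator f) (ContinuousLinearMap.lsmul ℝ ℝ)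
        volume = convolution (Ω.indicator f) (fun w => (((φ i).normed volume w : ℝ) : ℂ))
        (ContinuousLinearMap.mul ℝ ℂ) volume := by
      funext x
      rw [convolution_eq_swap, convolution_def]
      refine integral_congr_ae (Filter.Eventually.of_forall fun t => ?_)
      simp [mul_comm]
    rw [e]
    intro w hw'
    refine (differentiableAt_convolution ho.measurableSet hf hw
      (Complex.ofRealCLM.contDiff.comp (φ i).contDiff_normed) (δ := (φ i).rOut) ?_
      (hball w hw' _ ((hφr i).trans (by linarith)))).differentiableWithinAt
    intro w hw
    have : w ∉ Function.support ((φ i).normed volume) := by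
      rw [(φ i).support_normed_eq]
      simpa using hw
    simpa using this
  · intro w hw'
    rw [Metric.mem_ball] at hzr ⊢
    rw [Metric.mem_closedBall] at hw'
    linarith [dist_triangle w z z₀]

/-- Weyl's lemma for `∂̄`: an essentially bounded weakly holomorphic function agrees almost
everywhere with a bounded holomorphic function. -/
theorem IsWeaklyHolomorphicOn.exists_isBoundedHolomorphic (ho : IsOpen Ω)
    (hb : Bornology.IsBounded Ω) {f : (Fin n → ℂ) → ℂ} (hf : MemLp f ∞ (volume.restrict Ω))
    (hw : IsWeaklyHolomorphicOn f Ω) :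
    ∃ F : (Fin n → ℂ) → ℂ, IsBoundedHolomorphic Ω F ∧ f =ᵐ[volume.restrict Ω] F := by
  have : IsFiniteMeasure (volume.restrict Ω) := ⟨by
    rw [Measure.restrict_apply_univ]; exact hb.measure_lt_top⟩
  have hloc : LocallyIntegrable (Ω.indicator f) :=
    (IntegrableOn.integrable_indicator (hf.integrable le_top) ho.measurableSet).locallyIntegrable
  have hlocal := fun z₀ : Ω => hw.exists_local ho hloc z₀.2
  choose r hr hrΩ G hG hfG using hlocal
  classical
  set F : (Fin n → ℂ) → ℂ := fun z => if h : z ∈ Ω then G ⟨z, h⟩ z else 0 with hF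
  have hFG : ∀ z₀ : Ω, Set.EqOn F (G z₀) (Metric.ball z₀ (r z₀)) := by
    intro z₀ z hz
    have hzΩ := hrΩ z₀ hz
    simp only [hF, dif_pos hzΩ]
    -- Two local representatives are continuous and both agree with f almost everywhere, so they
    -- coincide on the overlap.
    have hopen : IsOpen (Metric.ball z (r ⟨z, hzΩ⟩) ∩ Metric.ball (z₀ : Fin n → ℂ) (r z₀)) :=
      Metric.isOpen_ball.inter Metric.isOpen_ball
    refine Measure.eqOn_open_of_ae_eq (μ := volume) ?_ hopen
      ((hG ⟨z, hzΩ⟩).continuousOn.mono Set.inter_subset_left)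
      ((hG z₀).continuousOn.mono Set.inter_subset_right) ⟨Metric.mem_ball_self (hr _), hz⟩
    rw [Filter.EventuallyEq, ae_restrict_iff' hopen.measurableSet]
    filter_upwards [hfG ⟨z, hzΩ⟩, hfG z₀] with w h1 h2 hw
    rw [← h1 hw.1, h2 hw.2]
  have hFd : DifferentiableOn ℂ F Ω := by
    intro z hz
    refine DifferentiableAt.differentiableWithinAt ?_
    have hn : Metric.ball z (r ⟨z, hz⟩) ∈ nhds z := Metric.ball_mem_nhds z (hr ⟨z, hz⟩)
    exact ((hG ⟨z, hz⟩).differentiableAt hn).congr_of_eventuallyEq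
      ((hFG ⟨z, hz⟩).eventuallyEq_of_mem hn)
  have hfF : f =ᵐ[volume.restrict Ω] F := by
    rw [Filter.EventuallyEq, ae_restrict_iff' ho.measurableSet, ae_iff]
    refine measure_null_of_locally_null _ fun z hz => ?_
    have hzΩ : z ∈ Ω := by
      by_contra h
      exact hz fun h' => absurd h' h
    refine ⟨{w | ¬(w ∈ Ω → f w = F w)} ∩ Metric.ball z (r ⟨z, hzΩ⟩),
      inter_mem_nhdsWithin _ (Metric.ball_mem_nhds z (hr _)), ?_⟩
    refine measure_mono_null ?_ (ae_iff.1 (hfG ⟨z, hzΩ⟩))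
    rintro w ⟨hw1, hw2⟩ hw3
    exact hw1 fun _ => by rw [hw3 hw2, hFG ⟨z, hzΩ⟩ hw2]
  refine ⟨F, ⟨hFd, (eLpNorm f ∞ (volume.restrict Ω)).toReal, ?_⟩, hfF⟩
  set C := (eLpNorm f ∞ (volume.restrict Ω)).toReal
  have hC : ∀ᵐ z ∂volume.restrict Ω, ‖F z‖ ≤ C := by
    filter_upwards [hfF, ae_le_eLpNormEssSup (f := f) (μ := volume.restrict Ω)] with z h1 h2
    rw [← h1, ← toReal_enorm]
    refine ENNReal.toReal_mono hf.2.ne ?_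
    rw [eLpNorm_exponent_top]
    exact h2
  by_contra! hcon
  obtain ⟨z, hz, hzC⟩ := hcon
  -- The essential bound holds everywhere: the set violating it is open and null, hence empty.
  have hopen : IsOpen (Ω ∩ (fun z => ‖F z‖) ⁻¹' Set.Ioi C) :=
    hFd.continuousOn.norm.isOpen_inter_preimage ho isOpen_Ioi
  refine (hopen.measure_pos volume ⟨z, hz, hzC⟩).ne' ?_
  rw [ae_restrict_iff' ho.measurableSet, ae_iff] at hC
  refine measure_mono_null ?_ hC
  rintro w ⟨hw1, hw2⟩ hw3
  exact absurd (hw3 hw1) (not_le.2 hw2)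

end

/-! ### Division near the point a and away from it -/

section

variable {n : ℕ}

theorem integrable_mul_of_continuousOn {U K : Set (Fin n → ℂ)} (hK : IsCompact K) (hKU : K ⊆ U)
    {F ψ : (Fin n → ℂ) → ℂ} (hF : ContinuousOn F U) (hψ : Continuous ψ) (h0 : ∀ z ∉ K, ψ z = 0) :
    Integrable fun z => F z * ψ z := by
  rw [← integrableOn_iff_integrable_of_support_subset (s := K)]
  · exact ((hF.mono hKU).mul hψ.continuousOn).integrableOn_compact hK
  · intro z hz
    by_contra h
    exact hz (by simp [h0 z h])

/-- Smoothness of F on U suffices: φ has compact support in U, so the integrals extend to ℂⁿ, where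
integration by parts has no boundary term. -/
theorem integral_mul_dbar {U : Set (Fin n → ℂ)} (hU : IsOpen U) {F φ : (Fin n → ℂ) → ℂ}
    (hF : ContDiffOn ℝ ∞ F U) (hφ : IsTestFunction U φ) (k : Fin n) :
    ∫ z in U, F z * dbar k φ z = -∫ z in U, dbar k F z * φ z := by
  have hz : ∀ z ∉ U, φ z = 0 := fun z h => image_eq_zero_of_notMem_tsupport fun h' => h (hφ.2.2 h')
  rw [setIntegral_eq_integral_of_forall_compl_eq_zero (fun z h => by
      rw [dbar_eq_zero_of_notMem_tsupport k fun h' => h (hφ.2.2 h'), mul_zero]),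
    setIntegral_eq_integral_of_forall_compl_eq_zero (fun z h => by rw [hz z h, mul_zero])]
  have hF' : ∀ v, ContinuousOn (fun z => fderiv ℝ F z v) U := fun v =>
    (hF.continuousOn_fderiv_of_isOpen hU (by simp)).clm_apply continuousOn_const
  have hφ' : ∀ v, Continuous (fun z => fderiv ℝ φ z v) := fun v =>
    (hφ.1.continuous_fderiv (by simp)).clm_apply continuous_const
  have h0 : ∀ z ∉ tsupport φ, φ z = 0 := fun z h => image_eq_zero_of_notMem_tsupport h
  have h0' : ∀ v, ∀ z ∉ tsupport φ, fderiv ℝ φ z v = 0 := fun v z h => by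
    rw [image_eq_zero_of_notMem_tsupport fun h' => h (tsupport_fderiv_subset ℝ h')]; rfl
  have i1 := fun v => integrable_mul_of_continuousOn hφ.2.1 hφ.2.2 (hF' v) hφ.1.continuous h0
  have i2 := fun v => integrable_mul_of_continuousOn hφ.2.1 hφ.2.2 hF.continuousOn (hφ' v) (h0' v)
  have key : ∀ v, ∫ z, F z * fderiv ℝ φ z v = -∫ z, fderiv ℝ F z v * φ z := fun v =>
    integral_mul_fderiv_eq_neg_fderiv_mul_of_integrable (i1 v) (i2 v)
      (integrable_mul_of_continuousOn hφ.2.1 hφ.2.2 hF.continuousOn hφ.1.continuous h0)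
      (fun z h => (hF.contDiffAt (hU.mem_nhds (hφ.2.2 h))).differentiableAt (by simp))
      (fun z _ => hφ.1.differentiable (by simp) z)
  have e1 : ∫ z, F z * dbar k φ z = (1 / 2) * ((∫ z, F z * fderiv ℝ φ z (Pi.single k 1)) +
      Complex.I * ∫ z, F z * fderiv ℝ φ z (Pi.single k Complex.I)) := by
    rw [← integral_const_mul, ← integral_add (i2 _) ((i2 _).const_mul _), ← integral_const_mul]
    congr 1; funext z; unfold dbar; ring
  have e2 : ∫ z, dbar k F z * φ z = (1 / 2) * ((∫ z, fderiv ℝ F z (Pi.single k 1) * φ z) +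
      Complex.I * ∫ z, fderiv ℝ F z (Pi.single k Complex.I) * φ z) := by
    rw [← integral_const_mul, ← integral_add (i1 _) ((i1 _).const_mul _), ← integral_const_mul]
    congr 1; funext z; unfold dbar; ring
  rw [e1, e2, key, key]
  ring

theorem isWeaklyHolomorphicOn_of_differentiableOn {U : Set (Fin n → ℂ)} (hU : IsOpen U)
    {F : (Fin n → ℂ) → ℂ} (hF : DifferentiableOn ℂ F U) : IsWeaklyHolomorphicOn F U := by
  intro k φ hφ
  rw [integral_mul_dbar hU (contDiffOn_of_differentiableOn hU hF) hφ, neg_eq_zero]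
  refine setIntegral_eq_zero_of_forall_eq_zero fun z hz => ?_
  rw [dbar_eq_zero_of_differentiableAt k (hF.differentiableAt (hU.mem_nhds hz)), zero_mul]

theorem dbar_fderiv_apply {G : (Fin n → ℂ) → ℂ} (hG : ContDiff ℝ ∞ G) (k : Fin n)
    (v z : Fin n → ℂ) :
    dbar k (fun z => fderiv ℝ G z v) z = fderiv ℝ (dbar k G) z v := by
  have hd : DifferentiableAt ℝ (fderiv ℝ G) z :=
    (hG.fderiv_right (m := ∞) (by simp)).differentiable (by simp) z
  have hs : IsSymmSndFDerivAt ℝ G z := (hG.contDiffAt (x := z)).isSymmSndFDerivAt (by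
    simpa using WithTop.coe_le_coe.2 (le_top : (2 : ℕ∞) ≤ ⊤))
  have h1 : ∀ w : Fin n → ℂ, HasFDerivAt (fun y => fderiv ℝ G y w)
      ((fderiv ℝ (fderiv ℝ G) z).flip w) z := fun w => by
    simpa using hd.hasFDerivAt.clm_apply (hasFDerivAt_const w z)
  have h2 : HasFDerivAt (dbar k G) _ z := ((h1 (Pi.single k 1)).add
      ((h1 (Pi.single k Complex.I)).const_mul Complex.I)).const_mul (1 / 2 : ℂ)
  rw [h2.fderiv, dbar, (h1 v).fderiv]
  simp only [ContinuousLinearMap.flip_apply, smul_apply, add_apply, smul_eq_mul]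
  rw [hs.eq v, hs.eq v]

/-- Hadamard's lemma for a holomorphic function near a zero, with weakly holomorphic
coefficients. -/
theorem exists_hadamard_factorization {Ω : Set (Fin n → ℂ)} (ho : IsOpen Ω) {a : Fin n → ℂ}
    (ha : a ∈ Ω) {g : (Fin n → ℂ) → ℂ} (hg : DifferentiableOn ℂ g Ω) (hga : g a = 0) :
    ∃ ρ > 0, Metric.ball a ρ ⊆ Ω ∧ ∃ h : Fin n → (Fin n → ℂ) → ℂ, (∀ j, Continuous (h j)) ∧
      (∀ j, IsWeaklyHolomorphicOn (h j) (Metric.ball a ρ)) ∧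
      ∀ z ∈ Metric.ball a ρ, ∑ j, (z j - a j) * h j z = g z := by
  obtain ⟨R, hR, hRΩ⟩ := Metric.isOpen_iff.1 ho a ha
  let η : ContDiffBump a := ⟨R / 4, R / 2, by positivity, by linarith⟩
  -- The cutoff makes G smooth on all of ℂⁿ, so the coefficients are continuous everywhere, while G
  -- = g on the ball of radius R/4.
  set G : (Fin n → ℂ) → ℂ := fun z => (η z : ℂ) * g z with hGdef
  have hG : ContDiff ℝ ∞ G := by
    rw [contDiff_iff_contDiffAt]
    intro z
    by_cases hz : z ∈ Ω
    · exact (Complex.ofRealCLM.contDiff.comp η.contDiff).contDiffAt.mul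
        ((contDiffOn_of_differentiableOn ho hg).contDiffAt (ho.mem_nhds hz))
    · refine contDiffAt_const (c := (0 : ℂ)).congr_of_eventuallyEq ?_
      have hz' : z ∉ tsupport η := fun h => hz (hRΩ (by
        rw [η.tsupport_eq] at h
        exact Metric.closedBall_subset_ball (half_lt_self hR) h))
      filter_upwards [notMem_tsupport_iff_eventuallyEq.1 hz'] with w hw
      simp [hGdef, hw]
  set B := Metric.ball a (R / 4) with hB
  have hBΩ : B ⊆ Ω := (Metric.ball_subset_ball (by linarith)).trans hRΩ
  have hGg : Set.EqOn G g B := fun z hz => by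
    simp only [hGdef]
    rw [η.one_of_mem_closedBall (Metric.ball_subset_closedBall hz), Complex.ofReal_one, one_mul]
  have hGd : DifferentiableOn ℂ G B := (hg.mono hBΩ).congr hGg
  have hBo : IsOpen B := Metric.isOpen_ball
  set D : Fin n → (Fin n → ℂ) → ℂ := fun j z => fderiv ℝ G z (Pi.single j 1) with hD
  have hDsm : ∀ j, ContDiff ℝ ∞ (D j) := fun j =>
    (hG.fderiv_right (m := ∞) (by simp)).clm_apply contDiff_const
  have hDhol : ∀ j, DifferentiableOn ℂ (D j) B := by
    intro j z hz
    refine (differentiableAt_of_dbar_eq_zero ((hDsm j).differentiable (by simp) z)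
      fun k => ?_).differentiableWithinAt
    rw [hD, dbar_fderiv_apply hG]
    have : dbar k G =ᶠ[nhds z] fun _ => 0 := by
      filter_upwards [hBo.mem_nhds hz] with w hw
      exact dbar_eq_zero_of_differentiableAt k (hGd.differentiableAt (hBo.mem_nhds hw))
    rw [this.fderiv_eq]
    simp
  have hcontDt : ∀ j, Continuous fun p : (Fin n → ℂ) × ℝ => D j (a + p.2 • (p.1 - a)) := fun j =>
    (hDsm j).continuous.comp (by fun_prop)
  have hseg : ∀ z ∈ B, ∀ t ∈ Set.Icc (0 : ℝ) 1, a + t • (z - a) ∈ B := fun z hz t ht =>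
    (convex_ball a (R / 4)).add_smul_sub_mem (Metric.mem_ball_self (by positivity)) hz ht
  refine ⟨R / 4, by positivity, hBΩ, fun j z => ∫ t in (0 : ℝ)..1, D j (a + t • (z - a)), ?_, ?_, ?_⟩
  · intro j
    exact intervalIntegral.continuous_parametric_intervalIntegral_of_continuous'
      (f := fun z t => D j (a + t • (z - a))) (hcontDt j) 0 1
  -- By Fubini it suffices to test for each fixed t, where the integrand is holomorphic in z; no
  -- differentiation under the integral is needed.
  · intro j k φ hφ
    have hφ' : Continuous (dbar k φ) := (contDiff_dbar hφ.1 k).continuous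
    have hint : Integrable (Function.uncurry fun (z : Fin n → ℂ) (t : ℝ) =>
        D j (a + t • (z - a)) * dbar k φ z)
        ((volume.restrict B).prod (volume.restrict (Set.Ioc 0 1))) := by
      rw [Measure.prod_restrict]
      have hc : Continuous (Function.uncurry fun (z : Fin n → ℂ) (t : ℝ) =>
        D j (a + t • (z - a)) * dbar k φ z) := (hcontDt j).mul (hφ'.comp continuous_fst)
      exact (hc.continuousOn.integrableOn_compact
        ((isCompact_closedBall a (R / 4)).prod (isCompact_Icc (a := (0 : ℝ)) (b := 1)))).mono_set
        (Set.prod_mono Metric.ball_subset_closedBall Set.Ioc_subset_Icc_self)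
    have hswap := integral_integral_swap hint
    simp only [integral_mul_const] at hswap
    simp only [intervalIntegral.integral_of_le zero_le_one]
    rw [← hB, hswap]
    refine setIntegral_eq_zero_of_forall_eq_zero fun t ht => ?_
    refine isWeaklyHolomorphicOn_of_differentiableOn hBo ((hDhol j).comp ?_ fun z hz =>
      hseg z hz t (Set.Ioc_subset_Icc_self ht)) k φ hφ
    fun_prop
  · intro z hz
    have hderiv : ∀ t ∈ Set.uIcc (0 : ℝ) 1, HasDerivAt (fun t : ℝ => G (a + t • (z - a)))
        (∑ j, (z j - a j) * D j (a + t • (z - a))) t := by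
      intro t ht
      rw [Set.uIcc_of_le zero_le_one] at ht
      have hline : HasDerivAt (fun t : ℝ => a + t • (z - a)) (z - a) t := by
        simpa using ((hasDerivAt_id t).smul_const (z - a)).const_add a
      have hmem := hseg z hz t ht
      have hc := (hGd.differentiableAt (hBo.mem_nhds hmem)).hasFDerivAt.restrictScalars ℝ
      have hDp : ∀ j, D j (a + t • (z - a)) =
          fderiv ℂ G (a + t • (z - a)) (Pi.single j 1) := fun j => by
        change fderiv ℝ G _ _ = _
        rw [hc.fderiv]
        rfl
      have hsum : ∑ j, (z j - a j) * D j (a + t • (z - a)) =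
          fderiv ℂ G (a + t • (z - a)) (z - a) := by
        simp only [hDp]
        generalize fderiv ℂ G (a + t • (z - a)) = T
        conv_rhs => rw [← Finset.univ_sum_single (z - a), map_sum]
        refine Finset.sum_congr rfl fun j _ => ?_
        rw [← smul_eq_mul, ← map_smul, ← Pi.single_smul]
        simp
      rw [hsum]
      exact hc.comp_hasDerivAt t hline
    have hDc : ∀ j, Continuous fun t : ℝ => D j (a + t • (z - a)) := fun j =>
      (hDsm j).continuous.comp (by fun_prop)
    have := intervalIntegral.integral_eq_sub_of_hasDerivAt hderiv
      (Continuous.intervalIntegrable (continuous_finsetSum _ fun j _ =>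
        continuous_const.mul (hDc j)) 0 1)
    have hi : ∀ j ∈ Finset.univ, IntervalIntegrable
        (fun t : ℝ => (z j - a j) * D j (a + t • (z - a))) volume 0 1 := fun j _ =>
      (continuous_const.mul (hDc j)).intervalIntegrable 0 1
    rw [intervalIntegral.integral_finsetSum hi] at this
    simp only [intervalIntegral.integral_const_mul] at this
    refine this.trans ?_
    rw [one_smul, zero_smul, add_sub_cancel, add_zero, hGg hz,
      hGg (Metric.mem_ball_self (by positivity)), hga, sub_zero]

/-- A smooth partition `1 = ∑ (z_j - a_j) ξ_j + χ` with `χ` a cutoff function at `a`. -/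
theorem exists_smooth_division (a : Fin n → ℂ) {r : ℝ} (hr : 0 < r) :
    ∃ (ξ : Fin n → (Fin n → ℂ) → ℂ) (χ : (Fin n → ℂ) → ℂ), (∀ j, ContDiff ℝ ∞ (ξ j)) ∧
      ContDiff ℝ ∞ χ ∧ (∀ z, ∑ j, (z j - a j) * ξ j z + χ z = 1) ∧
      (∀ k z, ∑ j, (z j - a j) * dbar k (ξ j) z + dbar k χ z = 0) ∧
      tsupport χ ⊆ Metric.closedBall a r ∧ (∀ z ∈ Metric.ball a (r / 2), χ z = 1) ∧
      ∀ j, ∀ z ∈ Metric.ball a (r / 2), ξ j z = 0 := by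
  let η : ContDiffBump a := ⟨r / 2, r, by positivity, by linarith⟩
  have hχ : ContDiff ℝ ∞ fun z => (η z : ℂ) := Complex.ofRealCLM.contDiff.comp η.contDiff
  have h1 : ∀ z ∈ Metric.ball a (r / 2), (η z : ℂ) = 1 := fun z hz => by
    rw [η.one_of_mem_closedBall (Metric.ball_subset_closedBall hz), Complex.ofReal_one]
  set N : (Fin n → ℂ) → ℂ := fun z => ∑ j, (z j - a j) * star (z j - a j) with hN
  have hN' : ∀ z, N z = ((∑ j, ‖z j - a j‖ ^ 2 : ℝ) : ℂ) := fun z => by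
    simp only [hN]
    push_cast
    exact Finset.sum_congr rfl fun j _ => Complex.mul_conj' _
  have hN0 : ∀ z, N z = 0 → z = a := fun z hz => by
    rw [hN', Complex.ofReal_eq_zero, Finset.sum_eq_zero_iff_of_nonneg fun j _ => by positivity] at hz
    funext j
    simpa [sub_eq_zero] using hz j (Finset.mem_univ j)
  have hcoord : ∀ j, ContDiff ℝ ∞ fun z : Fin n → ℂ => z j - a j := fun j =>
    (contDiff_apply ℝ ℂ j).sub contDiff_const
  have hstar : ∀ j, ContDiff ℝ ∞ fun z : Fin n → ℂ => star (z j - a j) := fun j =>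
    Complex.conjCLE.contDiff.comp (hcoord j)
  have hNs : ContDiff ℝ ∞ N := ContDiff.sum fun j _ => (hcoord j).mul (hstar j)
  -- The factor 1 - η vanishes near a and removes the singularity of 1/|z - a|².
  set ξ : Fin n → (Fin n → ℂ) → ℂ := fun j z => (1 - (η z : ℂ)) * star (z j - a j) * (N z)⁻¹
  have hξ0 : ∀ j, ∀ z ∈ Metric.ball a (r / 2), ξ j z = 0 := fun j z hz => by
    simp [ξ, h1 z hz]
  have hξ : ∀ j, ContDiff ℝ ∞ (ξ j) := by
    intro j
    rw [contDiff_iff_contDiffAt]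
    intro z
    by_cases hz : z = a
    · refine contDiffAt_const (c := (0 : ℂ)).congr_of_eventuallyEq ?_
      rw [hz]
      filter_upwards [Metric.ball_mem_nhds a (half_pos hr)] with w hw using hξ0 j w hw
    · exact ((contDiff_const.sub hχ).mul (hstar j)).contDiffAt.mul
        (hNs.contDiffAt.inv fun h => hz (hN0 z h))
  have hsum : ∀ z, ∑ j, (z j - a j) * ξ j z + η z = 1 := by
    intro z
    have e : ∑ j, (z j - a j) * ξ j z = (1 - (η z : ℂ)) * (N z * (N z)⁻¹) := by
      conv_rhs => rw [hN]
      simp only [ξ, Finset.sum_mul, Finset.mul_sum]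
      exact Finset.sum_congr rfl fun j _ => by ring
    rw [e]
    by_cases hz : N z = 0
    · rw [hN0 z hz, h1 a (Metric.mem_ball_self (half_pos hr))]
      ring
    · rw [mul_inv_cancel₀ hz]
      ring
  refine ⟨ξ, fun z => (η z : ℂ), hξ, hχ, hsum, fun k z => ?_, ?_, h1, hξ0⟩
  · have hd : ∀ j, DifferentiableAt ℝ (fun z => (z j - a j) * ξ j z) z := fun j =>
      ((hcoord j).mul (hξ j)).differentiable (by simp) z
    have h := dbar_const k (1 : ℂ) z
    rw [← funext hsum, dbar_add k (DifferentiableAt.fun_sum fun j _ => hd j)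
      (hχ.differentiable (by simp) z), dbar_sum _ k fun j _ => hd j] at h
    rw [← h]
    congr 1
    refine Finset.sum_congr rfl fun j _ => ?_
    rw [dbar_mul k ((hcoord j).differentiable (by simp) z) ((hξ j).differentiable (by simp) z),
      dbar_eq_zero_of_differentiableAt (φ := fun z => z j - a j) k (by fun_prop), mul_zero, add_zero]
  · refine closure_minimal (fun z hz => ?_) Metric.isClosed_closedBall
    have : z ∈ Function.support η := fun h => hz (by simp [h])
    rw [η.support_eq] at this
    exact Metric.ball_subset_closedBall this

end

/-! ### The bounded decomposition of g -/

section

variable {n : ℕ} {Ω : Set (Fin n → ℂ)}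

theorem WeakDbarEq.const_mul (hb : Bornology.IsBounded Ω) (hm : MeasurableSet Ω) {s : ℕ}
    {f : ZeroForm n s} {h : ZeroForm n (s + 1)} (hf : IsLInftyForm Ω f) (hh : IsLInftyForm Ω h)
    (H : WeakDbarEq Ω f h) (c : ℂ) :
    WeakDbarEq Ω (fun J z => c * f J z) (fun K z => c * h K z) := by
  have := H.smooth_mul hb hm (contDiff_const (c := c)) hf hh
  simpa [dbarWedge, dbar_const] using this

/-- The `(0,1)`-form with the coefficient functions `β k`. -/
def oneForm (β : Fin n → (Fin n → ℂ) → ℂ) : ZeroForm n 1 := fun K z =>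
  ∑ k : {k : Fin n // k ∈ K.1}, K.sign k.1 * β k.1 z

theorem isLInftyForm_oneForm {β : Fin n → (Fin n → ℂ) → ℂ}
    (hβ : ∀ k, MemLp (β k) ∞ (volume.restrict Ω)) : IsLInftyForm Ω (oneForm β) := fun _ =>
  memLp_finsetSum _ fun k _ => (hβ k.1).const_mul _

theorem weakDbarEq_oneForm {f : (Fin n → ℂ) → ℂ} {β : Fin n → (Fin n → ℂ) → ℂ}
    (hβ : ∀ k, MemLp (β k) ∞ (volume.restrict Ω))
    (H : ∀ k φ, IsTestFunction Ω φ → ∫ z in Ω, f z * dbar k φ z = -∫ z in Ω, β k z * φ z) :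
    WeakDbarEq Ω (fun _ : MultiIndex n 0 => f) (oneForm β) := by
  intro K φ hφ
  simp only [oneForm, Finset.sum_mul]
  rw [integral_finsetSum _ fun k _ => hφ.integrable_mul ((hβ k.1).const_mul _),
    ← Finset.sum_neg_distrib]
  refine Finset.sum_congr rfl fun k _ => ?_
  simp only [mul_assoc]
  rw [H k.1 φ hφ, integral_const_mul, mul_neg]

/-- The component K = {k} of the equation has a single term, with sign 1. -/
theorem isWeaklyHolomorphicOn_of_weakDbarEq_zero {f : ZeroForm n 0} (H : WeakDbarEq Ω f 0)
    (J : MultiIndex n 0) : IsWeaklyHolomorphicOn (f J) Ω := by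
  intro k φ hφ
  have hK := H ⟨{k}, Finset.card_singleton k⟩ φ hφ
  have hs : ∀ g : {j : Fin n // j ∈ ({k} : Finset (Fin n))} → ℂ,
      ∑ j, g j = g ⟨k, Finset.mem_singleton_self k⟩ := fun g =>
    Fintype.sum_eq_single _ fun j hj =>
      absurd (Subtype.ext (Finset.mem_singleton.1 j.2)) hj
  rw [hs] at hK
  have hJ : (MultiIndex.remove ⟨{k}, Finset.card_singleton k⟩ ⟨k, Finset.mem_singleton_self k⟩ :
      MultiIndex n 0) = J :=
    Subtype.ext (by rw [Finset.card_eq_zero.1 J.2]; simp [MultiIndex.remove])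
  rw [hJ] at hK
  simpa [MultiIndex.sign] using hK

/-- The Leibniz rule for a weakly holomorphic function, tested on products only. -/
theorem integral_smooth_mul_dbar {f ψ φ : (Fin n → ℂ) → ℂ} (hf : MemLp f ∞ (volume.restrict Ω))
    (hψ : ContDiff ℝ ∞ ψ) (hφ : IsTestFunction Ω φ) (k : Fin n)
    (h : ∫ z in Ω, f z * dbar k (fun z => ψ z * φ z) z = 0) :
    ∫ z in Ω, f z * ψ z * dbar k φ z = -∫ z in Ω, f z * dbar k ψ z * φ z := by
  rw [← zero_sub, ← h, ← integral_sub (((hφ.mul_left hψ).dbar k).integrable_mul hf)]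
  · refine integral_congr_ae (Filter.Eventually.of_forall fun z => ?_)
    simp only
    rw [dbar_mul k (hψ.differentiable (by simp) z) (hφ.1.differentiable (by simp) z)]
    ring
  · simp only [mul_assoc]
    exact (hφ.mul_left (contDiff_dbar hψ k)).integrable_mul hf

theorem IsWeaklyHolomorphicOn.integral_eq_zero_of_subset {B : Set (Fin n → ℂ)} (hBΩ : B ⊆ Ω)
    {f : (Fin n → ℂ) → ℂ} (hf : IsWeaklyHolomorphicOn f B) {φ : (Fin n → ℂ) → ℂ}
    (hφ : IsTestFunction B φ) (k : Fin n) : ∫ z in Ω, f z * dbar k φ z = 0 := by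
  have h0 : ∀ z ∉ B, f z * dbar k φ z = 0 := fun z hz => by
    rw [dbar_eq_zero_of_notMem_tsupport k fun h => hz (hφ.2.2 h), mul_zero]
  rw [setIntegral_eq_integral_of_forall_compl_eq_zero fun z hz => h0 z fun h => hz (hBΩ h),
    ← setIntegral_eq_integral_of_forall_compl_eq_zero h0]
  exact hf k φ hφ

/-- A bounded decomposition `g = ∑ (z_j - a_j) u_j` with weak derivatives `∂̄_k u_j = β_{jk}` that
are bounded, vanish near `a` and satisfy `∑ (z_j - a_j) β_{jk} = 0`. -/
theorem exists_bounded_decomposition (ho : IsOpen Ω) (hb : Bornology.IsBounded Ω)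
    {a : Fin n → ℂ} (ha : a ∈ Ω) {g : (Fin n → ℂ) → ℂ} (hg : IsBoundedHolomorphic Ω g)
    (hga : g a = 0) : ∃ (u : Fin n → (Fin n → ℂ) → ℂ) (β : Fin n → Fin n → (Fin n → ℂ) → ℂ),
      (∀ j, MemLp (u j) ∞ (volume.restrict Ω)) ∧
      (∀ j k, MemLp (β j k) ∞ (volume.restrict Ω)) ∧
      (∀ j k φ, IsTestFunction Ω φ →
        ∫ z in Ω, u j z * dbar k φ z = -∫ z in Ω, β j k z * φ z) ∧
      (∀ z ∈ Ω, ∑ j, (z j - a j) * u j z = g z) ∧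
      (∀ k z, ∑ j, (z j - a j) * β j k z = 0) ∧
      ∃ r > 0, ∀ j k, ∀ z ∈ Metric.ball a r, β j k z = 0 := by
  have hm := ho.measurableSet
  obtain ⟨hgd, C, hC⟩ := hg
  obtain ⟨ρ, hρ, hρΩ, h, hhc, hhw, hhg⟩ := exists_hadamard_factorization ho ha hgd hga
  obtain ⟨ξ, χ, hξ, hχ, hsum, hsum', hsupp, hχ1, hξ0⟩ := exists_smooth_division a (half_pos hρ)
  set B := Metric.ball a ρ
  have hsuppB : tsupport χ ⊆ B := hsupp.trans (Metric.closedBall_subset_ball (half_lt_self hρ))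
  -- Extension by zero makes the bounded coefficients β_{jk} satisfy their linear relation at every
  -- z, not only in Ω.
  set g₀ := Ω.indicator g with hg₀
  have hg₀e : ∀ z ∈ Ω, g₀ z = g z := fun z hz => Set.indicator_of_mem hz g
  have hg₀L : MemLp g₀ ∞ (volume.restrict Ω) := by
    refine MemLp.ae_eq (f := g) ?_ ?_
    · rw [Filter.EventuallyEq, ae_restrict_iff' hm]
      exact Filter.Eventually.of_forall fun z hz => (hg₀e z hz).symm
    · exact memLp_top_of_bound (hgd.continuousOn.aestronglyMeasurable hm) C
        ((ae_restrict_iff' hm).2 (Filter.Eventually.of_forall hC))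
  have hhL : ∀ j, MemLp (h j) ∞ (volume.restrict Ω) := fun j => by
    have : MemLp (fun _ : Fin n → ℂ => (1 : ℂ)) ∞ (volume.restrict Ω) := memLp_top_const 1
    simpa using memLp_top_continuous_mul hb hm (hhc j) this
  have hmulL : ∀ {f ψ : (Fin n → ℂ) → ℂ}, MemLp f ∞ (volume.restrict Ω) → ContDiff ℝ ∞ ψ →
      MemLp (fun z => f z * ψ z) ∞ (volume.restrict Ω) := fun hf hψ => by
    simpa only [mul_comm] using memLp_top_continuous_mul hb hm hψ.continuous hf
  have hg₀w : IsWeaklyHolomorphicOn g₀ Ω := fun k φ hφ => by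
    rw [← isWeaklyHolomorphicOn_of_differentiableOn ho hgd k φ hφ]
    exact setIntegral_congr_fun hm fun z hz => by simp only [hg₀e z hz]
  have hχh : ∀ z, (∑ j, (z j - a j) * h j z) * χ z = g₀ z * χ z := fun z => by
    by_cases hz : z ∈ B
    · rw [hhg z hz, hg₀e z (hρΩ hz)]
    · rw [image_eq_zero_of_notMem_tsupport fun h => hz (hsuppB h), mul_zero, mul_zero]
  have hχh' : ∀ k z, (∑ j, (z j - a j) * h j z) * dbar k χ z = g₀ z * dbar k χ z := fun k z => by
    by_cases hz : z ∈ B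
    · rw [hhg z hz, hg₀e z (hρΩ hz)]
    · rw [dbar_eq_zero_of_notMem_tsupport k fun h => hz (hsuppB h), mul_zero, mul_zero]
  -- Hadamard coefficients near a are glued to g ξ_j elsewhere. In the ∂̄-derivative g and h_j act
  -- as constants, and near a both ξ_j and χ are constant, so β vanishes there.
  refine ⟨fun j z => g₀ z * ξ j z + h j z * χ z,
    fun j k z => g₀ z * dbar k (ξ j) z + h j z * dbar k χ z,
    fun j => (hmulL hg₀L (hξ j)).add (hmulL (hhL j) hχ),
    fun j k => (hmulL hg₀L (contDiff_dbar (hξ j) k)).add (hmulL (hhL j) (contDiff_dbar hχ k)),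
    ?_, ?_, ?_, ρ / 2 / 2, by positivity, ?_⟩
  -- As h_j is weakly holomorphic only on B, its Leibniz rule is tested on χφ, whose support lies in
  -- B.
  · intro j k φ hφ
    simp only [add_mul]
    rw [integral_add ((hφ.dbar k).integrable_mul (hmulL hg₀L (hξ j)))
      ((hφ.dbar k).integrable_mul (hmulL (hhL j) hχ)),
      integral_add (hφ.integrable_mul (hmulL hg₀L (contDiff_dbar (hξ j) k)))
      (hφ.integrable_mul (hmulL (hhL j) (contDiff_dbar hχ k))),
      integral_smooth_mul_dbar hg₀L (hξ j) hφ k (hg₀w k _ (hφ.mul_left (hξ j))),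
      integral_smooth_mul_dbar (hhL j) hχ hφ k ((hhw j).integral_eq_zero_of_subset hρΩ
        ⟨hχ.mul hφ.1, hφ.2.1.mul_left, (tsupport_mul_subset_left (f := χ)).trans hsuppB⟩ k),
      neg_add]
  · intro z hz
    rw [← hg₀e z hz]
    have e : ∑ j, (z j - a j) * (g₀ z * ξ j z + h j z * χ z) =
        g₀ z * ∑ j, (z j - a j) * ξ j z + (∑ j, (z j - a j) * h j z) * χ z := by
      rw [Finset.mul_sum, Finset.sum_mul, ← Finset.sum_add_distrib]
      exact Finset.sum_congr rfl fun j _ => by ring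
    rw [e, hχh z]
    linear_combination g₀ z * hsum z
  · intro k z
    have e : ∑ j, (z j - a j) * (g₀ z * dbar k (ξ j) z + h j z * dbar k χ z) =
        g₀ z * ∑ j, (z j - a j) * dbar k (ξ j) z +
          (∑ j, (z j - a j) * h j z) * dbar k χ z := by
      rw [Finset.mul_sum, Finset.sum_mul, ← Finset.sum_add_distrib]
      exact Finset.sum_congr rfl fun j _ => by ring
    rw [e, hχh' k z]
    linear_combination g₀ z * hsum' k z
  · intro j k z hz
    have hn := Metric.isOpen_ball.mem_nhds hz
    have h1 : dbar k (ξ j) z = 0 := by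
      rw [dbar_congr k (Set.EqOn.eventuallyEq_of_mem (g := fun _ => 0) (hξ0 j) hn), dbar_const]
    have h2 : dbar k χ z = 0 := by
      rw [dbar_congr k (Set.EqOn.eventuallyEq_of_mem (g := fun _ => 1) hχ1 hn), dbar_const]
    simp only [h1, h2, mul_zero, add_zero]

end

/-! ### The Koszul differential and its homotopy -/

section

variable {n : ℕ} {Ω : Set (Fin n → ℂ)} {ι : Type*}

/-- The Koszul differential `∑ (z_j - a_j) E_j`. -/
def koszulMatrix (E : Fin n → Matrix ι ι ℂ) (a z : Fin n → ℂ) : Matrix ι ι ℂ :=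
  ∑ j, (z j - a j) • E j

theorem koszulMatrix_entry (E : Fin n → Matrix ι ι ℂ) (a z : Fin n → ℂ) (b c : ι) :
    koszulMatrix E a z b c = ∑ j, (z j - a j) * E j b c := by
  simp [koszulMatrix, Matrix.sum_apply]

-- Since `E i` kills e, the relations give E_i F_j e = δ_{ij} e.
variable [Fintype ι] [DecidableEq ι] in
theorem koszulMatrix_mulVec {E F : Fin n → Matrix ι ι ℂ} {e : ι → ℂ}
    (hF : ∀ i j, E i * F j + F j * E i = if i = j then 1 else 0)
    (he : ∀ i, (E i).mulVec e = 0) (a z : Fin n → ℂ) (j : Fin n) :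
    (koszulMatrix E a z).mulVec ((F j).mulVec e) = (z j - a j) • e := by
  rw [koszulMatrix, Matrix.sum_mulVec, Finset.sum_eq_single j]
  · rw [Matrix.smul_mulVec, Matrix.mulVec_mulVec, eq_sub_of_add_eq (hF j j), if_pos rfl,
      Matrix.sub_mulVec, ← Matrix.mulVec_mulVec, he, Matrix.mulVec_zero, sub_zero,
      Matrix.one_mulVec]
  · intro i _ hij
    rw [Matrix.smul_mulVec, Matrix.mulVec_mulVec, eq_sub_of_add_eq (hF i j), if_neg hij,
      Matrix.sub_mulVec, ← Matrix.mulVec_mulVec, he, Matrix.mulVec_zero, sub_zero,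
      Matrix.zero_mulVec, smul_zero]
  · simp

variable [Fintype ι] [DecidableEq ι] in
theorem koszulMatrix_mulVec_sum {E F : Fin n → Matrix ι ι ℂ} {e : ι → ℂ}
    (hF : ∀ i j, E i * F j + F j * E i = if i = j then 1 else 0)
    (he : ∀ i, (E i).mulVec e = 0) (a z x : Fin n → ℂ) :
    (koszulMatrix E a z).mulVec (fun b => ∑ j, (F j).mulVec e b * x j) =
      (∑ j, (z j - a j) * x j) • e := by
  have : (fun b => ∑ j, (F j).mulVec e b * x j) = ∑ j, x j • (F j).mulVec e := by
    funext b
    simp [mul_comm]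
  rw [this, Matrix.mulVec_sum, Finset.sum_smul]
  refine Finset.sum_congr rfl fun j _ => ?_
  rw [Matrix.mulVec_smul, koszulMatrix_mulVec hF he, smul_smul, mul_comm]

/-- The homotopy `∑ ξ_j F_j` for the Koszul differential. -/
def homotopyMatrix (F : Fin n → Matrix ι ι ℂ) (ξ : Fin n → (Fin n → ℂ) → ℂ) (z : Fin n → ℂ) :
    Matrix ι ι ℂ :=
  ∑ j, ξ j z • F j

theorem homotopyMatrix_entry (F : Fin n → Matrix ι ι ℂ) (ξ : Fin n → (Fin n → ℂ) → ℂ)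
    (z : Fin n → ℂ) (b c : ι) : homotopyMatrix F ξ z b c = ∑ j, ξ j z * F j b c := by
  simp [homotopyMatrix, Matrix.sum_apply]

theorem contDiff_homotopyMatrix (F : Fin n → Matrix ι ι ℂ) {ξ : Fin n → (Fin n → ℂ) → ℂ}
    (hξ : ∀ j, ContDiff ℝ ∞ (ξ j)) (b c : ι) :
    ContDiff ℝ ∞ fun z => homotopyMatrix F ξ z b c := by
  simp only [homotopyMatrix_entry]
  exact ContDiff.sum fun j _ => (hξ j).mul contDiff_const

theorem dbarMatrix_homotopyMatrix (F : Fin n → Matrix ι ι ℂ) {ξ : Fin n → (Fin n → ℂ) → ℂ}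
    (hξ : ∀ j, ContDiff ℝ ∞ (ξ j)) (k : Fin n) (z : Fin n → ℂ) :
    dbarMatrix k (homotopyMatrix F ξ) z = ∑ j, dbar k (ξ j) z • F j := by
  have hd : ∀ j, DifferentiableAt ℝ (ξ j) z := fun j => (hξ j).differentiable (by simp) z
  ext b c
  simp only [dbarMatrix, Matrix.of_apply, homotopyMatrix_entry, Matrix.sum_apply,
    Matrix.smul_apply, smul_eq_mul]
  have hd' : ∀ j ∈ Finset.univ, DifferentiableAt ℝ (fun z => ξ j z * F j b c) z := fun j _ =>
    (hd j).mul (differentiableAt_const _)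
  rw [dbar_sum _ k hd']
  refine Finset.sum_congr rfl fun j _ => ?_
  rw [dbar_mul k (hd j) (differentiableAt_const _), dbar_const, mul_zero, zero_add, mul_comm]

end

end SCV

end

/-! ### Gleason solvability -/

theorem mainTheorem1 (n : ℕ) (Ω : Set (Fin n → ℂ)) (hΩ : SCV.IsLInftyPseudoconvexDomain Ω) :
    SCV.IsGleasonSolvable Ω := by
  open SCV in
  intro a ha g hg hga
  have ho := hΩ.isOpen
  have hm := ho.measurableSet
  have hb := hΩ.isBounded
  obtain ⟨u, β, huL, hβL, huβ, hug, hβ0, r, hr, hβr⟩ :=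
    exists_bounded_decomposition ho hb ha hg hga
  -- With radius r/2, the cutoff χ vanishes on A = {r/2 < |z - a|}, so the homotopy identity holds
  -- there, while off A the β_{jk} are zero.
  obtain ⟨ξ, χ, hξ, -, hsum, hsum', hsupp, -, -⟩ := exists_smooth_division a (half_pos hr)
  obtain ⟨ι, _, _, E, F, e, i₀, hE, hF, he, he1⟩ := exists_clifford_matrices n
  set P := koszulMatrix E a with hP
  set X := homotopyMatrix F ξ with hX
  have hχ : ∀ z ∈ {z | r / 2 < dist z a}, z ∉ tsupport χ := fun z hz h =>
    absurd (Metric.mem_closedBall.1 (hsupp h)) (not_le.2 hz)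
  have hU0 : ∀ j, WeakDbarEq Ω (fun _ : MultiIndex n 0 => u j) (oneForm (β j)) := fun j =>
    weakDbarEq_oneForm (hβL j) (huβ j)
  have hUL : ∀ j, IsLInftyForm Ω (fun _ : MultiIndex n 0 => u j) := fun j _ => huL j
  have hBL : ∀ j, IsLInftyForm Ω (oneForm (β j)) := fun j => isLInftyForm_oneForm (hβL j)
  -- v = ∑ u_j F_j e encodes the decomposition as Pv = g e on Ω, and b = ∂̄v.
  set v : ι → ZeroForm n 0 := fun i _ z => ∑ j, (F j).mulVec e i * u j z with hv
  set b : ι → ZeroForm n 1 := fun i K z => ∑ j, (F j).mulVec e i * oneForm (β j) K z with hbdef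
  have hvb : ∀ i, WeakDbarEq Ω (v i) (b i) := fun i =>
    WeakDbarEq.sum (fun j => (hUL j).continuous_mul hb hm continuous_const)
      (fun j => (hBL j).continuous_mul hb hm continuous_const)
      (fun j => (hU0 j).const_mul hb hm (hUL j) (hBL j) _)
  have hvL : ∀ i, IsLInftyForm Ω (v i) := fun i =>
    IsLInftyForm.sum fun j => (hUL j).continuous_mul hb hm continuous_const
  have hbL : ∀ i, IsLInftyForm Ω (b i) := fun i =>
    IsLInftyForm.sum fun j => (hBL j).continuous_mul hb hm continuous_const
  obtain ⟨w, hwL, hwb, hPw⟩ := exists_weakDbarEq_mulForm_eq_zero hb hm hΩ.solvable (P := P)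
    (X := X) (A := {z | r / 2 < dist z a})
    (by
      intro i j
      simp only [hP, koszulMatrix_entry]
      exact ContDiff.sum fun l _ => ((contDiff_apply ℝ ℂ l).sub contDiff_const).mul contDiff_const)
    (by
      intro i j k z
      simp only [hP, koszulMatrix_entry]
      exact dbar_eq_zero_of_differentiableAt k (by fun_prop))
    (fun z => clifford_sq_eq_zero hE _) (contDiff_homotopyMatrix F hξ)
    (by
      intro z hz
      have h := hsum z
      rw [image_eq_zero_of_notMem_tsupport (hχ z hz), add_zero] at h
      rw [hP, hX, koszulMatrix, homotopyMatrix, clifford_mul_add_mul hF, h, one_smul])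
    (by
      intro z hz k
      have h := hsum' k z
      rw [dbar_eq_zero_of_notMem_tsupport k (hχ z hz), add_zero] at h
      rw [hP, hX, dbarMatrix_homotopyMatrix F hξ, koszulMatrix, clifford_mul_add_mul hF, h,
        zero_smul])
    n 0 (by simp) b hbL (fun i => (hvb i).isClosed)
    (by
      funext i K z
      refine congrFun (?_ : (fun i => mulForm P b i K z) = 0) i
      rw [mulForm_apply, hbdef, hP, koszulMatrix_mulVec_sum hF he]
      have : ∑ j, (z j - a j) * oneForm (β j) K z = 0 := by
        simp only [oneForm, Finset.mul_sum]
        rw [Finset.sum_comm]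
        refine Finset.sum_eq_zero fun k _ => ?_
        rw [Finset.sum_congr rfl fun j _ => mul_left_comm _ _ _, ← Finset.mul_sum, hβ0, mul_zero]
      rw [this, zero_smul])
    (by
      intro z hz i K
      have hz' : z ∈ Metric.ball a r := (not_lt.1 hz).trans_lt (half_lt_self hr)
      simp only [hbdef, oneForm]
      refine Finset.sum_eq_zero fun j _ => ?_
      rw [Finset.sum_eq_zero fun k _ => by rw [hβr j k.1 z hz', mul_zero], mul_zero])
  have hclosed : ∀ i, WeakDbarEq Ω (v i - w i) 0 := fun i => by
    simpa using (hvb i).sub (hvL i) (hwL i) (hbL i) (hbL i) (hwb i)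
  set J : MultiIndex n 0 := ⟨∅, rfl⟩
  have hweyl := fun i => (isWeaklyHolomorphicOn_of_weakDbarEq_zero (hclosed i)
    J).exists_isBoundedHolomorphic ho hb ((hvL i J).sub (hwL i J))
  choose H hHb hHae using hweyl
  -- H represents v - w, so PH = g e. The row i₀, where e is 1, reads g = ∑ (z_j - a_j) (E_j
  -- H)_{i₀}; it holds almost everywhere, hence on Ω by continuity.
  refine ⟨fun j z => ∑ i, E j i₀ i * H i z, fun j => ⟨?_, ?_⟩, ?_⟩
  · exact DifferentiableOn.fun_sum fun i _ => (hHb i).1.const_mul _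
  · choose C hC using fun i => (hHb i).2
    refine ⟨∑ i, ‖E j i₀ i‖ * C i, fun z hz => (norm_sum_le _ _).trans ?_⟩
    refine Finset.sum_le_sum fun i _ => ?_
    rw [norm_mul]
    exact mul_le_mul_of_nonneg_left (hC i z hz) (norm_nonneg _)
  · have hcoord : ∀ j, ContinuousOn (fun z : Fin n → ℂ => z j - a j) Ω := fun j => by fun_prop
    refine Measure.eqOn_open_of_ae_eq (μ := volume) ?_ ho hg.1.continuousOn
      (continuousOn_finsetSum _ fun j _ => (hcoord j).mul
        (continuousOn_finsetSum _ fun i _ => continuousOn_const.mul (hHb i).1.continuousOn))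
    filter_upwards [(ae_all_iff.2 hHae), ae_restrict_mem hm] with z hz hzΩ
    have h1 : (P z).mulVec (fun i => H i z) = g z • e := by
      have h0 : (fun i => H i z) = fun i => (v i - w i) J z := (funext hz).symm
      have h2 : (P z).mulVec (fun i => w i J z) = 0 := by
        rw [← mulForm_apply, hPw]; rfl
      have h3 : (fun i => (v i - w i) J z) = (fun i => v i J z) - fun i => w i J z := rfl
      rw [h0, h3, Matrix.mulVec_sub, h2, sub_zero, hv, hP, koszulMatrix_mulVec_sum hF he, hug z hzΩ]
    have h4 := congrFun h1 i₀
    simp only [Matrix.mulVec, dotProduct, Pi.smul_apply, smul_eq_mul, he1, mul_one, hP,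
      koszulMatrix_entry] at h4
    rw [← h4]
    simp only [Finset.sum_mul, Finset.mul_sum, mul_assoc]
    exact Finset.sum_comm
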